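/- A mixed graph $G=(V,E_{\to},E_{\leftrightarrow})$ has a finite vertex set $V$, a set $E_{\to}$ of directed edges $u\to v$ with $u\neq v$, and a set $E_{\leftrightarrow}$ of bi-directed edges $u\leftrightarrow v$ (unordered pairs of distinct vertices). For $i\in V$ let $\mathrm{pa}(i)=\{j: j\to i\in E_{\to}\}$ and $\mathrm{sib}(i)=\{j: j\leftrightarrow i\in E_{\leftrightarrow}\}$, and let $G_{-i}$ be the subgraph induced on $V\setminus\{i\}$. A half-collider path is a path, with vertices $i_1,\dots,i_k$ ($k\ge 1$) that need not be distinct, either with all edges bi-directed, or with first edge $i_1\to i_2$ and all other edges bi-directed; a single vertex and a single directed edge are included. Its bi-directed portion is $\{i_1,\dots,i_k\}$ in the first case and $\{i_2,\dots,i_k\}$ in the second. A system of half-collider paths from $S_b$ to $S_e$, where $|S_b|=|S_e|=s$, consists of $s$ half-collider paths, each from a vertex of $S_b$ to a vertex of $S_e$, such that every vertex of $S_b$ is the first vertex of some path and every vertex of $S_e$ is the last vertex of some path. Consider the following condition on $G$: (a) For all $i\in V$, the graph $G_{-i}$ contains a system of half-collider paths from a subset of $V\setminus(\mathrm{pa}(i)\cup\{i\})$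 to $\mathrm{sib}(i)$ such that the bi-directed portions are pairwise disjoint. **Proposition.** For any mixed graph $G=(V,E_{\to},E_{\leftrightarrow})$, condition (a) can be checked in $\mathcal{O}(|V|^5)$ operations. That is, there is a single program for a random access machine which, given $|V|$ and the adjacency matrices of the directed and of the bi-directed edges with respect to any numbering of $V$, always halts after $\mathcal{O}(|V|^5)$ elementary operations and outputs $1$ if (a) holds and $0$ otherwise. Here an elementary operation is an access to a constant, a register or a memory cell, an addition, truncated subtraction, multiplication or comparison of natural numbers, an assignment or a test, and all numbers and addresses that occur are less than $(|V|+2)^c$ for a constant $c$, i.e. words have $\mathcal{O}(\log |V|)$ bits. -/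

import Mathlib

/-! ### Mixed graphs and half-collider paths -/

/-- A mixed graph on the vertex set `V`: a set of directed edges (ordered pairs, no self-loops)
and a set of bi-directed edges (unordered pairs of distinct vertices). The same two vertices may
be joined by several edges, e.g. by `u → v`, `v → u` and `u ↔ v`. -/
structure MixedGraph (V : Type*) where
  /-- `Dir u v` means that `u → v` is an edge. -/
  Dir : V → V → Prop
  /-- `Bi.Adj u v` means that `u ↔ v` is an edge. -/
  Bi : SimpleGraph V
  dir_irrefl : ∀ v, ¬ Dir v v

namespace MixedGraph

variable {V : Type*}

/-- The parents of `i`. -/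
def pa (G : MixedGraph V) (i : V) : Set V := {j | G.Dir j i}

/-- The siblings of `i`. -/
def sib (G : MixedGraph V) (i : V) : Set V := {j | G.Bi.Adj j i}

/-- The subgraph induced on a set of vertices. -/
def induce (G : MixedGraph V) (S : Set V) : MixedGraph S where
  Dir u v := G.Dir u v
  Bi := G.Bi.induce S
  dir_irrefl v := G.dir_irrefl v

/-- Half-collider paths from `u` to `v`: either all edges are bi-directed, or the first edge is
directed and all others are bi-directed. Vertices may repeat; the empty path `u` and a single
directed edge `u → v` are included. -/
inductive HalfColliderPath (G : MixedGraph V) : V → V → Type _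
  | bidirected {u v : V} (p : G.Bi.Walk u v) : HalfColliderPath G u v
  | directed {u m v : V} (h : G.Dir u m) (p : G.Bi.Walk m v) : HalfColliderPath G u v

/-- The bi-directed portion: all vertices of the path, except that the first one is dropped when
the path starts with a directed edge (it may of course come back later on the path). -/
def HalfColliderPath.portion {G : MixedGraph V} {u v : V} : G.HalfColliderPath u v → Set V
  | .bidirected p => {x | x ∈ p.support}
  | .directed _ p => {x | x ∈ p.support}

/-- A system of half-collider paths from `Sb` to `Se`: as many paths as `Sb` and as `Se` have
elements, each from a vertex of `Sb` to a vertex of `Se`, such that every vertex of `Sb` is the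
first vertex of some path and every vertex of `Se` is the last vertex of some path. -/
structure HalfColliderSystem (G : MixedGraph V) (Sb Se : Set V) where
  size : ℕ
  card_first : Sb.ncard = size
  card_last : Se.ncard = size
  first : Fin size → V
  last : Fin size → V
  path : ∀ l, G.HalfColliderPath (first l) (last l)
  range_first : Set.range first = Sb
  range_last : Set.range last = Se

/-- For every vertex `i`, the induced subgraph on `V \ {i}` contains a system of half-collider
paths from a subset of `V \ (pa(i) ∪ {i})` to `sib(i)` whose bi-directed portions are pairwise
disjoint. -/
def GraphicalCondition (G : MixedGraph V) : Prop :=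
  ∀ i : V, ∃ Sb : Set ({i}ᶜ : Set V), Sb ⊆ Subtype.val ⁻¹' (G.pa i ∪ {i})ᶜ ∧
    ∃ S : (G.induce {i}ᶜ).HalfColliderSystem Sb (Subtype.val ⁻¹' G.sib i),
      Pairwise fun k l => Disjoint (S.path k).portion (S.path l).portion

end MixedGraph

/-! ### A random access machine with a step count

Programs are finite, with finitely many registers and a random access memory, both holding natural
numbers. Every elementary operation (reading a constant, a register or a memory cell, an
arithmetic operation or comparison, an assignment, a test) costs one step. There is a word bound
`W`: an execution is only valid if every value that is computed, including every address, is
smaller than `W`. -/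

namespace RAM

/-- Contents of the registers and of the memory. -/
structure State where
  reg : ℕ → ℕ
  mem : ℕ → ℕ

inductive Expr
  | const (k : ℕ)
  | reg (r : ℕ)
  | load (a : Expr)
  | add (a b : Expr)
  | sub (a b : Expr)
  | mul (a b : Expr)
  | lt (a b : Expr)
  | eq (a b : Expr)

/-- The value of an expression. Subtraction is truncated at `0`; a comparison yields `0` or `1`. -/
def Expr.val (s : State) : Expr → ℕ
  | .const k => k
  | .reg r => s.reg r
  | .load a => s.mem (a.val s)
  | .add a b => a.val s + b.val s
  | .sub a b => a.val s - b.val s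
  | .mul a b => a.val s * b.val s
  | .lt a b => if a.val s < b.val s then 1 else 0
  | .eq a b => if a.val s = b.val s then 1 else 0

/-- The number of operations for the evaluation of an expression. -/
def Expr.cost : Expr → ℕ
  | .const _ => 1
  | .reg _ => 1
  | .load a => a.cost + 1
  | .add a b => a.cost + b.cost + 1
  | .sub a b => a.cost + b.cost + 1
  | .mul a b => a.cost + b.cost + 1
  | .lt a b => a.cost + b.cost + 1
  | .eq a b => a.cost + b.cost + 1

/-- All values that occur in the evaluation of an expression are smaller than `W`. -/
def Expr.Fits (W : ℕ) (s : State) : Expr → Prop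
  | .const k => k < W
  | .reg r => s.reg r < W
  | .load a => a.Fits W s ∧ s.mem (a.val s) < W
  | .add a b => a.Fits W s ∧ b.Fits W s ∧ a.val s + b.val s < W
  | .sub a b => a.Fits W s ∧ b.Fits W s
  | .mul a b => a.Fits W s ∧ b.Fits W s ∧ a.val s * b.val s < W
  | .lt a b => a.Fits W s ∧ b.Fits W s ∧ 1 < W
  | .eq a b => a.Fits W s ∧ b.Fits W s ∧ 1 < W

inductive Prog
  | skip
  | assign (r : ℕ) (e : Expr)
  | store (a e : Expr)
  | seq (p q : Prog)
  | ite (b : Expr) (p q : Prog)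
  | loop (b : Expr) (p : Prog)

/-- `Exec W p s t s'`: with word bound `W`, the program `p` started in the state `s` halts after
exactly `t` steps in the state `s'`. -/
inductive Exec (W : ℕ) : Prog → State → ℕ → State → Prop
  | skip (s : State) : Exec W .skip s 1 s
  | assign (r : ℕ) (e : Expr) (s : State) (he : e.Fits W s) :
      Exec W (.assign r e) s (e.cost + 1) { s with reg := Function.update s.reg r (e.val s) }
  | store (a e : Expr) (s : State) (ha : a.Fits W s) (he : e.Fits W s) :
      Exec W (.store a e) s (a.cost + e.cost + 1)
        { s with mem := Function.update s.mem (a.val s) (e.val s) }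
  | seq {p q : Prog} {s s' s'' : State} {t t' : ℕ} (hp : Exec W p s t s')
      (hq : Exec W q s' t' s'') : Exec W (.seq p q) s (t + t') s''
  | ite_true {b : Expr} {p q : Prog} {s s' : State} {t : ℕ} (hf : b.Fits W s)
      (hb : b.val s ≠ 0) (hp : Exec W p s t s') : Exec W (.ite b p q) s (b.cost + 1 + t) s'
  | ite_false {b : Expr} {p q : Prog} {s s' : State} {t : ℕ} (hf : b.Fits W s)
      (hb : b.val s = 0) (hq : Exec W q s t s') : Exec W (.ite b p q) s (b.cost + 1 + t) s'
  | loop_true {b : Expr} {p : Prog} {s s' s'' : State} {t t' : ℕ} (hf : b.Fits W s)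
      (hb : b.val s ≠ 0) (hp : Exec W p s t s') (hl : Exec W (.loop b p) s' t' s'') :
      Exec W (.loop b p) s (b.cost + 1 + t + t') s''
  | loop_false {b : Expr} {p : Prog} {s : State} (hf : b.Fits W s) (hb : b.val s = 0) :
      Exec W (.loop b p) s (b.cost + 1) s

/-- The machine is deterministic: the number of steps and the final state are determined by the
program and the initial state. -/
theorem Exec.deterministic {W : ℕ} {p : Prog} {s s₁ s₂ : State} {t₁ t₂ : ℕ}
    (h₁ : Exec W p s t₁ s₁) (h₂ : Exec W p s t₂ s₂) : t₁ = t₂ ∧ s₁ = s₂ := by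
  induction h₁ generalizing t₂ s₂ with
  | skip s => cases h₂; exact ⟨rfl, rfl⟩
  | assign r e s he => cases h₂; exact ⟨rfl, rfl⟩
  | store a e s ha he => cases h₂; exact ⟨rfl, rfl⟩
  | seq hp hq ihp ihq =>
    cases h₂ with
    | seq hp' hq' =>
      obtain ⟨rfl, rfl⟩ := ihp hp'
      obtain ⟨rfl, rfl⟩ := ihq hq'
      exact ⟨rfl, rfl⟩
  | ite_true hf hb hp ih =>
    cases h₂ with
    | ite_true _ _ hp' => obtain ⟨rfl, rfl⟩ := ih hp'; exact ⟨rfl, rfl⟩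
    | ite_false _ hb' _ => exact absurd hb' hb
  | ite_false hf hb hp ih =>
    cases h₂ with
    | ite_true _ hb' _ => exact absurd hb hb'
    | ite_false _ _ hp' => obtain ⟨rfl, rfl⟩ := ih hp'; exact ⟨rfl, rfl⟩
  | loop_true hf hb hp hl ihp ihl =>
    cases h₂ with
    | loop_true _ _ hp' hl' =>
      obtain ⟨rfl, rfl⟩ := ihp hp'
      obtain ⟨rfl, rfl⟩ := ihl hl'
      exact ⟨rfl, rfl⟩
    | loop_false _ hb' => exact absurd hb' hb
  | loop_false hf hb =>
    cases h₂ with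
    | loop_true _ hb' _ _ => exact absurd hb hb'
    | loop_false _ _ => exact ⟨rfl, rfl⟩

end RAM

open Classical in
/-- The input for a mixed graph whose vertices are numbered `0, …, n - 1` by `e`: register `0`
holds `n`, the cells `0, …, n² - 1` hold the adjacency matrix of the directed edges and the cells
`n², …, 2n² - 1` that of the bi-directed edges, row by row; everything else is `0`. -/
noncomputable def MixedGraph.input {V : Type*} {n : ℕ} (G : MixedGraph V) (e : V ≃ Fin n) :
    RAM.State where
  reg r := if r = 0 then n else 0
  mem a :=
    if (∃ u v, G.Dir u v ∧ a = (e u : ℕ) * n + e v) ∨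
        (∃ u v, G.Bi.Adj u v ∧ a = n * n + ((e u : ℕ) * n + e v)) then 1 else 0

/-!
A system of half-collider paths from a subset of `A` to `S` with disjoint bi-directed portions
amounts to an injective choice of predecessors: the predecessor of `w` is the vertex before `w` in
the portion that contains `w`, or the first vertex of the path if `w` begins the portion, or `w`
itself if `w` lies in no portion; an element of `S` as a vertex in a portion is the last one and
precedes nothing. Conversely, follow such a choice backwards from an element of `S`: as this is
not a predecessor, the vertices do not repeat until a first vertex is reached, and injectivity
makes the paths disjoint.

So the condition asks for every vertex `i` whether the vertices can be matched with `2n` possible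
predecessors. This is decided by an auction, in which bidders without an object buy a cheapest
suitable one, whose price then rises by one. If somebody finds all suitable objects priced at `n`
or more, there is no matching: fewer than `n` objects have owners, hence some `k ≤ n` is not a
price, and that bidder and the owners of the objects priced above `k` are suited by no other
objects than these, of which there are too few. As there are at most `2n²` sales, `2n² + 1` rounds
of `n` bids suffice, and a bid takes `O(n)` operations.
-/

/-! ### Matchings by auctions -/

/-- `adj` has a matching that covers all of `L`, the form in which Hall's theorem is stated in
Mathlib. -/
def HasMatching {L R : Type*} (adj : L → R → Prop) : Prop :=
  ∃ f : L → R, Function.Injective f ∧ ∀ l, adj l (f l)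

theorem hasMatching_iff_of_injective {L R L' R' : Type*} {adj : L → R → Prop}
    {adj' : L' → R' → Prop} {ι : L' → L} {κ : R' → R} (hι : ι.Injective) (hκ : κ.Injective)
    {l₀ : L} {r₀ : R} (hl₀ : ∀ l, l = l₀ ∨ l ∈ Set.range ι) (hr₀ : r₀ ∉ Set.range κ)
    (h₀ : adj l₀ r₀) (hadj : ∀ l r, adj (ι l) r ↔ ∃ r', κ r' = r ∧ adj' l r') :
    HasMatching adj ↔ HasMatching adj' := by
  classical
  constructor
  · rintro ⟨f, hf, hfadj⟩
    choose g hgf hgadj using fun l => (hadj l _).1 (hfadj (ι l))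
    refine ⟨g, fun l l' h => hι (hf ?_), hgadj⟩
    rw [← hgf, ← hgf, h]
  · rintro ⟨g, hg, hgadj⟩
    let f := Function.extend ι (κ ∘ g) fun _ => r₀
    have hf : ∀ l, f (ι l) = κ (g l) := hι.extend_apply _ _
    have hf₀ : ∀ l ∉ Set.range ι, l = l₀ ∧ f l = r₀ := fun l hl =>
      ⟨(hl₀ l).resolve_right hl, Function.extend_apply' _ _ _ hl⟩
    refine ⟨f, fun l l' h => ?_, fun l => ?_⟩
    · by_cases hl : l ∈ Set.range ι <;> by_cases hl' : l' ∈ Set.range ι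
      · obtain ⟨⟨v, rfl⟩, v', rfl⟩ := hl, hl'
        rw [hf, hf] at h
        rw [hg (hκ h)]
      · obtain ⟨v, rfl⟩ := hl
        exact absurd ⟨g v, by rw [← hf, h, (hf₀ l' hl').2]⟩ hr₀
      · obtain ⟨v, rfl⟩ := hl'
        exact absurd ⟨g v, by rw [← hf, ← h, (hf₀ l hl).2]⟩ hr₀
      · rw [(hf₀ l hl).1, (hf₀ l' hl').1]
    · by_cases hl : l ∈ Set.range ι
      · obtain ⟨v, rfl⟩ := hl
        exact (hadj v _).2 ⟨g v, (hf v).symm, hgadj v⟩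
      · rwa [(hf₀ l hl).2, (hf₀ l hl).1]

/-- The state of an auction with bidders `L` and objects `R`. The entry `bought l` is the last
object that `l` has bought; it is outdated when somebody else owns that object now, and
meaningless when `l` has not bought anything. -/
structure Auction (L R : Type*) where
  bought : L → R
  owner : R → Option L
  price : R → ℕ

namespace Auction

variable {L R : Type*} {adj : L → R → Prop} {A A' : Auction L R} {l l' : L} {r r' : R} {k : ℕ}

/-- The bidder `l` currently owns an object. -/
def Serves (A : Auction L R) (l : L) : Prop := A.owner (A.bought l) = some l

/-- The state before the first bid, where `b` holds the meaningless entries of `bought`. -/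
def start (b : L → R) : Auction L R := ⟨b, fun _ => none, fun _ => 0⟩

/-- The sum of all prices, which counts the sales so far. -/
def revenue [Fintype R] (A : Auction L R) : ℕ := ∑ r, A.price r

section Sell

variable [DecidableEq L] [DecidableEq R]

/-- The object `r` passes to the bidder `l`, and its price rises by one. -/
def sell (A : Auction L R) (l : L) (r : R) : Auction L R where
  bought := Function.update A.bought l r
  owner := Function.update A.owner r (some l)
  price := Function.update A.price r (A.price r + 1)

theorem owner_sell_eq_some :
    (A.sell l r).owner r' = some l' ↔ r' = r ∧ l' = l ∨ r' ≠ r ∧ A.owner r' = some l' := by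
  by_cases h : r' = r <;> simp [sell, h, eq_comm]

theorem price_le_price_sell (r' : R) : A.price r' ≤ (A.sell l r).price r' := by
  by_cases h : r' = r <;> simp [sell, h]

theorem Serves.of_sell (h : (A.sell l r).Serves l') (hne : l' ≠ l) : A.Serves l' := by
  have hbought : (A.sell l r).bought l' = A.bought l' := Function.update_of_ne hne _ _
  have howner := ((owner_sell_eq_some.1 h).resolve_left fun h => hne h.2).2
  rwa [hbought] at howner

theorem revenue_sell [Fintype R] : (A.sell l r).revenue = A.revenue + 1 := by
  rw [revenue, revenue, ← Finset.add_sum_erase _ A.price (Finset.mem_univ r), sell,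
    Finset.sum_update_of_mem (Finset.mem_univ r), Finset.sdiff_singleton_eq_erase]
  ring

end Sell

variable [Fintype L]

/-- The invariant of an auction in which bidders are only interested in objects adjacent to them:
owners were at most one unit away from the cheapest choice, and prices are capped by the number of
bidders. -/
structure IsValid (adj : L → R → Prop) (A : Auction L R) : Prop where
  bought_eq : ∀ ⦃r l⦄, A.owner r = some l → A.bought l = r
  adj_of_owner : ∀ ⦃r l⦄, A.owner r = some l → adj l r
  price_le_succ : ∀ ⦃r l⦄, A.owner r = some l → ∀ r', adj l r' → A.price r ≤ A.price r' + 1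
  exists_owner : ∀ ⦃r⦄, A.price r ≠ 0 → ∃ l, A.owner r = some l
  price_le : ∀ r, A.price r ≤ Fintype.card L

/-- The bidder `l` owns nothing and finds all suitable objects too expensive. -/
def PricedOut (adj : L → R → Prop) (A : Auction L R) (l : L) : Prop :=
  ¬ A.Serves l ∧ ∀ r, adj l r → Fintype.card L ≤ A.price r

/-- The auction may stop: everybody is served, or somebody is priced out. -/
def IsFinal (adj : L → R → Prop) (A : Auction L R) : Prop :=
  (∀ l, A.Serves l) ∨ ∃ l, A.PricedOut adj l

/-- The possible results of a bid of `l`, who buys one of the cheapest suitable objects. -/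
inductive Bid [DecidableEq L] [DecidableEq R] (adj : L → R → Prop) (A : Auction L R) (l : L) :
    Auction L R → Prop
  | served (h : A.Serves l) : Bid adj A l A
  | pricedOut (h : A.PricedOut adj l) : Bid adj A l A
  | buy {r : R} (h : ¬ A.Serves l) (hr : adj l r) (hlt : A.price r < Fintype.card L)
      (hmin : ∀ r', adj l r' → A.price r ≤ A.price r') : Bid adj A l (A.sell l r)

/-- The measure of progress: there have been `k` sales, unless the auction is over. -/
def HasReached [Fintype R] (adj : L → R → Prop) (A : Auction L R) (k : ℕ) : Prop :=
  k ≤ A.revenue ∨ A.IsFinal adj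

theorem isValid_start (adj : L → R → Prop) (b : L → R) : (start b).IsValid adj where
  bought_eq _ _ h := nomatch h
  adj_of_owner _ _ h := nomatch h
  price_le_succ _ _ h := nomatch h
  exists_owner _ h := absurd rfl h
  price_le _ := Nat.zero_le _

namespace IsValid

theorem ne_of_owner (hA : A.IsValid adj) (hl : ¬ A.Serves l) (hr : A.owner r = some l') :
    l' ≠ l := by
  rintro rfl
  exact hl (by rw [Serves, hA.bought_eq hr, hr])

theorem eq_of_owner (hA : A.IsValid adj) (hr : A.owner r = some l) (hr' : A.owner r' = some l) :
    r = r' := (hA.bought_eq hr).symm.trans (hA.bought_eq hr')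

theorem hasMatching_of_serves (hA : A.IsValid adj) (h : ∀ l, A.Serves l) : HasMatching adj :=
  ⟨A.bought, fun l l' e => Option.some.inj <| (h l).symm.trans (e ▸ h l'),
    fun l => hA.adj_of_owner (h l)⟩

theorem exists_price_gap (hA : A.IsValid adj) (hl : ¬ A.Serves l) :
    ∃ k ≤ Fintype.card L, ∀ r, A.price r ≠ k := by
  by_contra! hgap
  choose r hr using fun i : Fin (Fintype.card L) => hgap (i + 1) i.isLt
  choose o ho using fun i => hA.exists_owner (r := r i) (by simp [hr])
  have ho_inj : o.Injective := fun i j hij => by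
    have hrij := congrArg A.price (hA.eq_of_owner (ho i) (hij ▸ ho j))
    rw [hr, hr] at hrij
    exact Fin.ext (Nat.succ.inj hrij)
  obtain ⟨i, hi⟩ :=
    ((Fintype.bijective_iff_injective_and_card o).2 ⟨ho_inj, Fintype.card_fin _⟩).surjective l
  exact hA.ne_of_owner hl (ho i) hi

theorem not_hasMatching [Finite R] (hA : A.IsValid adj) (hl : A.PricedOut adj l) :
    ¬ HasMatching adj := by
  rintro ⟨f, hf, hfadj⟩
  obtain ⟨k, hk, hgap⟩ := hA.exists_price_gap hl.1
  choose o ho using fun r : {r // k < A.price r} => hA.exists_owner (Nat.ne_zero_of_lt r.2)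
  have hl_expensive : k < A.price (f l) :=
    lt_of_le_of_ne (hk.trans (hl.2 _ (hfadj l))) (hgap _).symm
  have ho_expensive : ∀ r, k < A.price (f (o r)) := fun r =>
    lt_of_le_of_ne (Nat.le_of_lt_succ (r.2.trans_le (hA.price_le_succ (ho r) _ (hfadj _))))
      (hgap _).symm
  let φ : {r // k < A.price r} → {r // k < A.price r} := fun r => ⟨f (o r), ho_expensive r⟩
  have hφ : φ.Injective := fun r r' h => Subtype.ext <|
    hA.eq_of_owner (ho r) (hf (Subtype.ext_iff.1 h) ▸ ho r')
  obtain ⟨r, hr⟩ := Finite.surjective_of_injective hφ ⟨f l, hl_expensive⟩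
  exact hA.ne_of_owner hl.1 (ho r) (hf (Subtype.ext_iff.1 hr))

theorem hasMatching_iff [Finite R] (hA : A.IsValid adj) (hfinal : A.IsFinal adj) :
    HasMatching adj ↔ ∀ l, A.Serves l :=
  ⟨fun h => hfinal.resolve_right fun ⟨_, hl⟩ => hA.not_hasMatching hl h, hA.hasMatching_of_serves⟩

theorem revenue_le [Fintype R] (hA : A.IsValid adj) :
    A.revenue ≤ Fintype.card R * Fintype.card L :=
  Finset.sum_le_card_nsmul _ _ _ fun r _ => hA.price_le r

end IsValid

namespace IsValid

variable [DecidableEq L] [DecidableEq R]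

theorem sell (hA : A.IsValid adj) (hl : ¬ A.Serves l) (hr : adj l r)
    (hlt : A.price r < Fintype.card L) (hmin : ∀ r', adj l r' → A.price r ≤ A.price r') :
    (A.sell l r).IsValid adj where
  bought_eq r' l' h := by
    obtain ⟨rfl, rfl⟩ | ⟨-, h⟩ := owner_sell_eq_some.1 h
    · exact Function.update_self ..
    · exact (Function.update_of_ne (hA.ne_of_owner hl h) ..).trans (hA.bought_eq h)
  adj_of_owner r' l' h := by
    obtain ⟨rfl, rfl⟩ | ⟨-, h⟩ := owner_sell_eq_some.1 h
    exacts [hr, hA.adj_of_owner h]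
  price_le_succ r' l' h r'' hr'' := by
    refine le_trans ?_ (Nat.succ_le_succ (price_le_price_sell r''))
    obtain ⟨rfl, rfl⟩ | ⟨hne, h⟩ := owner_sell_eq_some.1 h
    · simpa [Auction.sell] using hmin r'' hr''
    · simpa [Auction.sell, hne] using hA.price_le_succ h r'' hr''
  exists_owner r' h := by
    simp only [owner_sell_eq_some]
    by_cases hne : r' = r
    · exact ⟨l, .inl ⟨hne, rfl⟩⟩
    · obtain ⟨l', hl'⟩ := hA.exists_owner (r := r') (by simpa [Auction.sell, hne] using h)
      exact ⟨l', .inr ⟨hne, hl'⟩⟩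
  price_le r' := by
    by_cases hne : r' = r
    · simpa [Auction.sell, hne] using hlt
    · simpa [Auction.sell, hne] using hA.price_le r'

end IsValid

namespace Bid

variable [DecidableEq L] [DecidableEq R]

theorem isValid (h : A.Bid adj l A') (hA : A.IsValid adj) : A'.IsValid adj := by
  cases h with
  | served | pricedOut => exact hA
  | buy hl hr hlt hmin => exact hA.sell hl hr hlt hmin

theorem isFinal (h : A.Bid adj l A') (hA : A.IsFinal adj) : A'.IsFinal adj := by
  cases h with
  | served | pricedOut => exact hA
  | buy hl hr hlt =>
    obtain ⟨l', hl', hexpensive⟩ := hA.resolve_left fun h => hl (h l)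
    have hne : l' ≠ l := by
      rintro rfl
      exact hlt.not_ge (hexpensive _ hr)
    exact .inr ⟨l', fun h => hl' (h.of_sell hne),
      fun r' hr' => (hexpensive r' hr').trans (price_le_price_sell r')⟩

variable [Fintype R]

theorem revenue_le (h : A.Bid adj l A') : A.revenue ≤ A'.revenue := by
  cases h with
  | served | pricedOut => exact le_rfl
  | buy => exact (Nat.le_succ _).trans_eq revenue_sell.symm

theorem hasReached (h : A.Bid adj l A') (hA : A.HasReached adj k) : A'.HasReached adj k :=
  hA.imp (·.trans h.revenue_le) h.isFinal

theorem hasReached_succ (h : A.Bid adj l A') (hA : A.HasReached adj k) :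
    (A' = A ∧ A.Serves l) ∨ A'.HasReached adj (k + 1) := by
  have hfinal := h.isFinal
  cases h with
  | served hl => exact .inl ⟨rfl, hl⟩
  | pricedOut hl => exact .inr (.inr (.inr ⟨l, hl⟩))
  | buy => exact .inr (hA.imp (fun hk => (Nat.succ_le_succ hk).trans_eq revenue_sell.symm) hfinal)

end Bid

end Auction

/-! ### Half-collider systems and predecessors -/

namespace MixedGraph

variable {V : Type*} {G : MixedGraph V} {A S : Set V}

/-- The possible predecessors of `w` in a system of half-collider paths from a subset of `A` to
`S`: `inl u` stands for `u` as a first vertex, `inr u` for `u` in a bi-directed portion. A vertex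
outside of all portions is regarded as its own predecessor. -/
def IsPredecessor (G : MixedGraph V) (A S : Set V) (w : V) : V ⊕ V → Prop
  | .inl u => u ∈ A ∧ (u = w ∨ G.Dir u w)
  | .inr u => u ∉ S ∧ (u = w ∨ G.Bi.Adj u w)

section Predecessors

variable {ι : Type*} {first start last : ι → V} {q : ∀ k, G.Bi.Walk (start k) (last k)}

/-- The predecessors that a family of walks `q k` assigns to the vertices, where the first vertex
of `q k` is preceded by `first k`. -/
inductive Precedes (first : ι → V) (q : ∀ k, G.Bi.Walk (start k) (last k)) : V → V ⊕ V → Prop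
  | start (k : ι) : Precedes first q (start k) (.inl (first k))
  | dart {k : ι} {d : G.Bi.Dart} (hd : d ∈ (q k).darts) : Precedes first q d.snd (.inr d.fst)
  | stay {w : V} (hw : ∀ k, w ∉ (q k).support) : Precedes first q w (.inr w)

theorem Precedes.exists_right (first : ι → V) (q : ∀ k, G.Bi.Walk (start k) (last k)) (w : V) :
    ∃ x, Precedes first q w x := by
  by_cases h : ∀ k, w ∉ (q k).support
  · exact ⟨_, .stay h⟩
  · push Not at h
    obtain ⟨k, hk⟩ := h
    obtain rfl | hk := (q k).mem_support_iff.1 hk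
    · exact ⟨_, .start k⟩
    · obtain ⟨d, hd, rfl⟩ := List.mem_map.1 ((q k).map_snd_darts ▸ hk)
      exact ⟨_, .dart hd⟩

theorem Precedes.left_unique (hfirst : first.Injective) (hq : ∀ k, (q k).IsPath)
    (hdisj : ∀ k l x, x ∈ (q k).support → x ∈ (q l).support → k = l) {w w' : V} {x : V ⊕ V}
    (h : Precedes first q w x) (h' : Precedes first q w' x) : w = w' := by
  cases h with
  | start k =>
    generalize hu : first k = u at h'
    cases h' with
    | start l => rw [hfirst hu]
  | @dart k d hd =>
    have hfst := (q k).dart_fst_mem_support_of_mem_darts hd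
    generalize hu : d.fst = u at h' hfst
    cases h' with
    | @dart l d' hd' =>
      obtain rfl := hdisj k l _ hfst ((q l).dart_fst_mem_support_of_mem_darts hd')
      have hnodup : ((q k).darts.map (·.fst)).Nodup :=
        (q k).map_fst_darts ▸ (hq k).support_nodup.sublist (List.dropLast_sublist _)
      rw [List.inj_on_of_nodup_map hnodup hd hd' hu]
    | stay hw => exact absurd hfst (hw k)
  | stay hw =>
    generalize hu : w = u at h'
    cases h' with
    | @dart l d' hd' => exact absurd (hu ▸ (q l).dart_fst_mem_support_of_mem_darts hd') (hw l)
    | stay => rfl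

theorem Precedes.isPredecessor (hA : ∀ k, first k ∈ A)
    (hstart : ∀ k, first k = start k ∨ G.Dir (first k) (start k)) (hq : ∀ k, (q k).IsPath)
    (hdisj : ∀ k l x, x ∈ (q k).support → x ∈ (q l).support → k = l) {w : V} {x : V ⊕ V}
    (h : Precedes first q w x) : G.IsPredecessor A (Set.range last) w x := by
  cases h with
  | start k => exact ⟨hA k, hstart k⟩
  | @dart k d hd =>
    refine ⟨?_, .inr d.adj⟩
    rintro ⟨l, hl⟩
    obtain rfl : l = k := hdisj _ _ _ (q l).end_mem_support
      (hl ▸ (q k).dart_fst_mem_support_of_mem_darts hd)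
    have hnodup := (hq l).support_nodup
    rw [← (q l).map_fst_darts_append, List.nodup_append] at hnodup
    exact hnodup.2.2 _ (List.mem_map_of_mem hd) _ (List.mem_singleton_self _) hl.symm
  | stay hw =>
    refine ⟨?_, .inl rfl⟩
    rintro ⟨k, rfl⟩
    exact hw k (q k).end_mem_support

end Predecessors

theorem HalfColliderPath.exists_isPath {u v : V} (P : G.HalfColliderPath u v) :
    ∃ (a : V) (q : G.Bi.Walk a v),
      q.IsPath ∧ (∀ x ∈ q.support, x ∈ P.portion) ∧ (u = a ∨ G.Dir u a) := by
  classical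
  cases P with
  | bidirected p =>
    exact ⟨_, p.bypass, p.bypass_isPath, fun x hx => p.support_bypass_subset_support hx, .inl rfl⟩
  | directed h p =>
    exact ⟨_, p.bypass, p.bypass_isPath, fun x hx => p.support_bypass_subset_support hx, .inr h⟩

theorem HalfColliderSystem.first_injective {Sb Se : Set V} (P : G.HalfColliderSystem Sb Se) :
    P.first.Injective := by
  rw [← Set.injOn_univ, ← Set.ncard_image_iff Set.finite_univ, Set.image_univ, P.range_first,
    Set.ncard_univ, Nat.card_fin, P.card_first]

theorem HalfColliderSystem.hasMatching_isPredecessor {Sb : Set V}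
    (P : G.HalfColliderSystem Sb S) (hSb : Sb ⊆ A)
    (hP : Pairwise fun k l => Disjoint (P.path k).portion (P.path l).portion) :
    HasMatching (G.IsPredecessor A S) := by
  choose start q hq hqP hstart using fun k => (P.path k).exists_isPath
  have hdisj : ∀ k l x, x ∈ (q k).support → x ∈ (q l).support → k = l := by
    intro k l x hk hl
    by_contra hne
    exact Set.disjoint_left.1 (hP hne) (hqP k x hk) (hqP l x hl)
  choose f hf using Precedes.exists_right P.first q
  refine ⟨f, fun w w' h => (hf w).left_unique P.first_injective hq hdisj (h ▸ hf w'), fun w => ?_⟩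
  rw [← P.range_last]
  exact (hf w).isPredecessor (fun k => hSb (P.range_first.subset ⟨k, rfl⟩)) hstart hq hdisj

theorem exists_halfColliderSystem_of_injective [Finite V] {b : S → V} (hb : b.Injective)
    (Q : ∀ t : S, G.HalfColliderPath (b t) t)
    (hQ : Pairwise fun t t' => Disjoint (Q t).portion (Q t').portion) :
    ∃ P : G.HalfColliderSystem (Set.range b) S,
      Pairwise fun k l => Disjoint (P.path k).portion (P.path l).portion := by
  let e : Fin S.ncard ≃ S := (Finite.equivFin S).symm
  exact ⟨{
    size := S.ncard
    card_first := by rw [← Set.image_univ, Set.ncard_image_of_injective _ hb, Set.ncard_univ]; rfl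
    card_last := rfl
    first := b ∘ e
    last := fun l => e l
    path := fun l => Q (e l)
    range_first := e.surjective.range_comp b
    range_last := (e.surjective.range_comp ((↑) : S → V)).trans Subtype.range_coe },
    fun k l hkl => hQ (e.injective.ne hkl)⟩

section Chains

variable {f : V → V ⊕ V}

/-- `Leads f t x` means that `x` is reached from `t` by passing to predecessors in the bi-directed
portions, as prescribed by `f`. -/
def Leads (f : V → V ⊕ V) : V → V → Prop := Relation.ReflTransGen fun w u => f w = .inr u

theorem Leads.left_unique (hf : f.Injective) (hS : ∀ t ∈ S, ∀ w, f w ≠ .inr t) {t t' x : V}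
    (ht : t ∈ S) (ht' : t' ∈ S) (h : Leads f t x) (h' : Leads f t' x) : t = t' := by
  have hunique : Relator.RightUnique (Function.swap fun w u => f w = .inr u) :=
    fun _ _ _ h h' => hf (h.trans h'.symm)
  have htotal := Relation.ReflTransGen.total_of_right_unique hunique h.swap h'.swap
  rcases htotal with h | h <;> obtain h | ⟨w, -, hw⟩ := h.swap.cases_tail
  · exact h
  · exact absurd hw (hS t ht w)
  · exact h.symm
  · exact absurd hw (hS t' ht' w)

/-- Otherwise `f` would permute the vertices to which `t` leads, although `t` precedes nothing. -/
theorem Leads.exists_eq_inl [Finite V] (hf : f.Injective) {t : V} (ht : ∀ w, f w ≠ .inr t) :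
    ∃ x u, Leads f t x ∧ f x = .inl u := by
  by_contra! hinl
  have hinr : ∀ x : {x // Leads f t x}, ∃ y : {x // Leads f t x}, f x = .inr y := by
    rintro ⟨x, hx⟩
    rcases hfx : f x with u | u
    · exact absurd hfx (hinl x u hx)
    · exact ⟨⟨u, hx.tail hfx⟩, rfl⟩
  choose g hg using hinr
  have hg_inj : g.Injective := fun x y hxy => Subtype.ext (hf (by rw [hg, hg, hxy]))
  obtain ⟨x, hx⟩ := Finite.surjective_of_injective hg_inj ⟨t, .refl⟩
  exact ht x (by rw [hg, hx])

theorem Leads.exists_walk (hpred : ∀ w, G.IsPredecessor A S w (f w)) {t x : V}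
    (h : Leads f t x) : ∃ p : G.Bi.Walk x t, ∀ y ∈ p.support, Leads f t y := by
  induction h with
  | refl => exact ⟨.nil, fun y hy => List.mem_singleton.1 hy ▸ .refl⟩
  | @tail x u hx hu ih =>
    obtain ⟨p, hp⟩ := ih
    have hux := hpred x
    rw [hu] at hux
    obtain rfl | hadj := hux.2
    · exact ⟨p, hp⟩
    · exact ⟨.cons hadj p, by simpa using ⟨hx.tail hu, hp⟩⟩

theorem Leads.exists_halfColliderPath [Finite V] (hf : f.Injective)
    (hpred : ∀ w, G.IsPredecessor A S w (f w)) {t : V} (ht : ∀ w, f w ≠ .inr t) :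
    ∃ x, ∃ u ∈ A, Leads f t x ∧ f x = .inl u ∧
      ∃ Q : G.HalfColliderPath u t, ∀ y ∈ Q.portion, Leads f t y := by
  obtain ⟨x, u, hx, hu⟩ := Leads.exists_eq_inl hf ht
  obtain ⟨p, hp⟩ := hx.exists_walk hpred
  have hux := hpred x
  rw [hu] at hux
  refine ⟨x, u, hux.1, hx, hu, ?_⟩
  obtain rfl | hdir := hux.2
  exacts [⟨.bidirected p, hp⟩, ⟨.directed hdir p, hp⟩]

end Chains

theorem exists_halfColliderSystem_of_hasMatching [Finite V]
    (h : HasMatching (G.IsPredecessor A S)) :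
    ∃ Sb ⊆ A, ∃ P : G.HalfColliderSystem Sb S,
      Pairwise fun k l => Disjoint (P.path k).portion (P.path l).portion := by
  obtain ⟨f, hf, hpred⟩ := h
  have hS : ∀ t ∈ S, ∀ w, f w ≠ .inr t := by
    intro t ht w hw
    have htw := hpred w
    rw [hw] at htw
    exact htw.1 ht
  choose x b hbA hx hxb Q hQ using fun t : S => Leads.exists_halfColliderPath hf hpred (hS t t.2)
  have hunique : ∀ {t t' : S} {y}, Leads f t y → Leads f t' y → t = t' := fun {t t' _} h h' =>
    Subtype.ext (h.left_unique hf hS t.2 t'.2 h')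
  have hb : b.Injective := fun t t' htt' => by
    have hxx : x t = x t' := hf (by rw [hxb, hxb, htt'])
    exact hunique (hx t) (hxx ▸ hx t')
  exact ⟨Set.range b, Set.range_subset_iff.2 hbA, exists_halfColliderSystem_of_injective hb Q
    fun t t' htt' => Set.disjoint_left.2 fun y hy hy' => htt' (hunique (hQ t y hy) (hQ t' y hy'))⟩

theorem exists_halfColliderSystem_iff [Finite V] :
    (∃ Sb ⊆ A, ∃ P : G.HalfColliderSystem Sb S,
      Pairwise fun k l => Disjoint (P.path k).portion (P.path l).portion) ↔
      HasMatching (G.IsPredecessor A S) :=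
  ⟨fun ⟨_, hSb, P, hP⟩ => P.hasMatching_isPredecessor hSb hP,
    exists_halfColliderSystem_of_hasMatching⟩

end MixedGraph

/-! ### Total correctness of programs -/

namespace RAM

/-- `v` encodes the truth value of `p`. -/
def IsTruthValue (v : ℕ) (p : Prop) : Prop := (p → v = 1) ∧ (¬ p → v = 0)

namespace IsTruthValue

variable {v v' : ℕ} {p q : Prop}

theorem ite (p : Prop) [Decidable p] : IsTruthValue (if p then 1 else 0) p :=
  ⟨fun h => if_pos h, fun h => if_neg h⟩

theorem le_one (h : IsTruthValue v p) : v ≤ 1 := by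
  by_cases hp : p
  · exact (h.1 hp).le
  · exact (h.2 hp).trans_le zero_le_one

theorem eq_zero_iff (h : IsTruthValue v p) : v = 0 ↔ ¬ p :=
  ⟨fun hv hp => by simp [h.1 hp] at hv, h.2⟩

theorem congr (h : IsTruthValue v p) (hpq : p ↔ q) : IsTruthValue v q := propext hpq ▸ h

theorem of_le_one (hv : v ≤ 1) : IsTruthValue v (v ≠ 0) := ⟨fun h => by omega, not_not.1⟩

theorem mul (h : IsTruthValue v p) (h' : IsTruthValue v' q) : IsTruthValue (v * v') (p ∧ q) := by
  by_cases hp : p <;> by_cases hq : q <;> simp_all [IsTruthValue]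

end IsTruthValue

namespace Expr

/-- Conjunction of two tests. -/
def and (a b : Expr) : Expr := .mul a b

/-- Disjunction of two tests. -/
def or (a b : Expr) : Expr := .lt (.const 0) (.add a b)

/-- Equivalence of two tests. -/
def iff (a b : Expr) : Expr := .eq a b

/-- Negation of a test. -/
def not (a : Expr) : Expr := .eq a (.const 0)

/-- With word bound `W`, the expression `e` has the value `v` in the state `s`. -/
def Evals (W : ℕ) (s : State) (e : Expr) (v : ℕ) : Prop := e.Fits W s ∧ e.val s = v

/-- With word bound `W`, the expression `e` decides `p` in the state `s`. -/
def Tests (W : ℕ) (s : State) (e : Expr) (p : Prop) : Prop :=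
  e.Fits W s ∧ IsTruthValue (e.val s) p

variable {W x y : ℕ} {s : State} {a b : Expr} {p q : Prop}

namespace Evals

theorem const {k : ℕ} (hk : k < W) : (const k).Evals W s k := ⟨hk, rfl⟩

theorem reg {r : ℕ} (hr : s.reg r = x) (hx : x < W) : (reg r).Evals W s x :=
  ⟨hr.trans_lt hx, hr⟩

theorem load (ha : a.Evals W s x) (hx : s.mem x = y) (hy : y < W) : (load a).Evals W s y := by
  obtain ⟨ha, rfl⟩ := ha
  exact ⟨⟨ha, hx.trans_lt hy⟩, hx⟩

theorem add (ha : a.Evals W s x) (hb : b.Evals W s y) (h : x + y < W) :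
    (add a b).Evals W s (x + y) := by
  obtain ⟨⟨ha, rfl⟩, hb, rfl⟩ := ha, hb
  exact ⟨⟨ha, hb, h⟩, rfl⟩

theorem mul (ha : a.Evals W s x) (hb : b.Evals W s y) (h : x * y < W) :
    (mul a b).Evals W s (x * y) := by
  obtain ⟨⟨ha, rfl⟩, hb, rfl⟩ := ha, hb
  exact ⟨⟨ha, hb, h⟩, rfl⟩

end Evals

namespace Tests

theorem evals (h : a.Tests W s p) : a.Evals W s (a.val s) := ⟨h.1, rfl⟩

theorem congr (h : a.Tests W s p) (hpq : p ↔ q) : a.Tests W s q := propext hpq ▸ h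

theorem eq (hW : 1 < W) (ha : a.Evals W s x) (hb : b.Evals W s y) :
    (eq a b).Tests W s (x = y) := by
  obtain ⟨⟨ha, rfl⟩, hb, rfl⟩ := ha, hb
  exact ⟨⟨ha, hb, hW⟩, .ite _⟩

theorem lt (hW : 1 < W) (ha : a.Evals W s x) (hb : b.Evals W s y) :
    (lt a b).Tests W s (x < y) := by
  obtain ⟨⟨ha, rfl⟩, hb, rfl⟩ := ha, hb
  exact ⟨⟨ha, hb, hW⟩, .ite _⟩

theorem reg {r : ℕ} (hW : 1 < W) (hr : IsTruthValue (s.reg r) p) : (reg r).Tests W s p :=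
  ⟨hr.le_one.trans_lt hW, hr⟩

theorem load (hW : 1 < W) (ha : a.Evals W s x) (hx : s.mem x ≤ 1) :
    (load a).Tests W s (s.mem x ≠ 0) := by
  obtain ⟨ha, rfl⟩ := ha
  exact ⟨⟨ha, hx.trans_lt hW⟩, .of_le_one hx⟩

theorem and (hW : 1 < W) (ha : a.Tests W s p) (hb : b.Tests W s q) :
    (a.and b).Tests W s (p ∧ q) :=
  have h := ha.2.mul hb.2
  ⟨⟨ha.1, hb.1, h.le_one.trans_lt hW⟩, h⟩

theorem or (hW : 2 < W) (ha : a.Tests W s p) (hb : b.Tests W s q) :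
    (a.or b).Tests W s (p ∨ q) := by
  have hsum : a.val s + b.val s < W := (add_le_add ha.2.le_one hb.2.le_one).trans_lt hW
  refine (Tests.lt (by omega) (.const (by omega)) (ha.evals.add hb.evals hsum)).congr ?_
  rw [Nat.pos_iff_ne_zero, Ne, Nat.add_eq_zero_iff, ha.2.eq_zero_iff, hb.2.eq_zero_iff]
  tauto

theorem iff (hW : 1 < W) (ha : a.Tests W s p) (hb : b.Tests W s q) :
    (a.iff b).Tests W s (p ↔ q) := by
  refine (Tests.eq hW ha.evals hb.evals).congr ?_
  obtain ⟨⟨-, ha⟩, -, hb⟩ := ha, hb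
  by_cases hp : p <;> by_cases hq : q <;> simp_all [IsTruthValue]

theorem not (hW : 1 < W) (ha : a.Tests W s p) : a.not.Tests W s (¬ p) :=
  (Tests.eq hW ha.evals (.const (by omega))).congr ha.2.eq_zero_iff

end Tests

end Expr

namespace State

/-- The state after an assignment to a register. -/
def setReg (s : State) (r v : ℕ) : State := { s with reg := Function.update s.reg r v }

/-- The state after an assignment to a memory cell. -/
def setMem (s : State) (a v : ℕ) : State := { s with mem := Function.update s.mem a v }

/-- Apart from `X`, the registers of the two states agree. -/
def SameOff (X : Finset ℕ) (s s' : State) : Prop := ∀ x ∉ X, s'.reg x = s.reg x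

variable {s : State}

@[simp]
theorem setReg_reg_self (r v : ℕ) : (s.setReg r v).reg r = v := Function.update_self ..

theorem setReg_reg_of_ne {r x : ℕ} (h : x ≠ r) (v : ℕ) : (s.setReg r v).reg x = s.reg x :=
  Function.update_of_ne h ..

theorem setMem_mem (a v x : ℕ) : (s.setMem a v).mem x = if x = a then v else s.mem x :=
  Function.update_apply ..

namespace SameOff

variable {X Y : Finset ℕ} {s' s'' : State}

theorem refl (X : Finset ℕ) (s : State) : s.SameOff X s := fun _ _ => rfl

theorem trans (h : s.SameOff X s') (h' : s'.SameOff X s'') : s.SameOff X s'' :=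
  fun x hx => (h' x hx).trans (h x hx)

theorem mono (h : s.SameOff X s') (hXY : X ⊆ Y) : s.SameOff Y s' :=
  fun x hx => h x (mt (@hXY x) hx)

theorem setReg {r : ℕ} (hr : r ∈ X) (v : ℕ) : s.SameOff X (s.setReg r v) :=
  fun _ hx => setReg_reg_of_ne (ne_of_mem_of_not_mem hr hx).symm v

end SameOff

end State

/-- The registers to which a program may assign. -/
def Prog.writes : Prog → Finset ℕ
  | .skip => ∅
  | .assign r _ => {r}
  | .store _ _ => ∅
  | .seq p q => p.writes ∪ q.writes
  | .ite _ p q => p.writes ∪ q.writes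
  | .loop _ p => p.writes

theorem Exec.sameOff_writes {W t : ℕ} {p : Prog} {s s' : State} (h : Exec W p s t s') :
    s.SameOff p.writes s' := by
  induction h with
  | skip | store | loop_false => exact .refl _ _
  | assign => exact .setReg (Finset.mem_singleton_self _) _
  | seq _ _ ihp ihq =>
    exact (ihp.mono Finset.subset_union_left).trans (ihq.mono Finset.subset_union_right)
  | ite_true _ _ _ ih => exact ih.mono Finset.subset_union_left
  | ite_false _ _ _ ih => exact ih.mono Finset.subset_union_right
  | loop_true _ _ _ _ ihp ihl => exact ihp.trans ihl

/-- Total correctness: with word bound `W` and started in `s`, the program `p` halts within `T`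
steps in a state that satisfies `Q`. -/
def HaltsWithin (W : ℕ) (p : Prog) (s : State) (T : ℕ) (Q : State → Prop) : Prop :=
  ∃ t s', Exec W p s t s' ∧ t ≤ T ∧ Q s'

namespace HaltsWithin

variable {W T T₁ T₂ k v : ℕ} {p q : Prog} {a b e : Expr} {s : State} {Q R : State → Prop}

theorem imp (h : HaltsWithin W p s T R) (hQ : ∀ s', R s' → Q s') : HaltsWithin W p s T Q :=
  let ⟨t, s', hexec, ht, hR⟩ := h
  ⟨t, s', hexec, ht, hQ s' hR⟩

theorem of_le (h : HaltsWithin W p s T₁ Q) (hT : T₁ ≤ T₂) : HaltsWithin W p s T₂ Q :=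
  let ⟨t, s', hexec, ht, hQ⟩ := h
  ⟨t, s', hexec, ht.trans hT, hQ⟩

theorem sameOff (h : HaltsWithin W p s T Q) :
    HaltsWithin W p s T fun s' => s.SameOff p.writes s' ∧ Q s' :=
  let ⟨t, s', hexec, ht, hQ⟩ := h
  ⟨t, s', hexec, ht, hexec.sameOff_writes, hQ⟩

theorem skip (h : Q s) : HaltsWithin W .skip s 1 Q := ⟨1, s, .skip s, le_rfl, h⟩

theorem assign {r : ℕ} (he : e.Evals W s v) (hQ : Q (s.setReg r v)) :
    HaltsWithin W (.assign r e) s (e.cost + 1) Q := by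
  obtain ⟨he, rfl⟩ := he
  exact ⟨_, _, .assign r e s he, le_rfl, hQ⟩

theorem store (ha : a.Evals W s k) (he : e.Evals W s v) (hQ : Q (s.setMem k v)) :
    HaltsWithin W (.store a e) s (a.cost + e.cost + 1) Q := by
  obtain ⟨⟨ha, rfl⟩, he, rfl⟩ := ha, he
  exact ⟨_, _, .store a e s ha he, le_rfl, hQ⟩

theorem seq (h : HaltsWithin W p s T₁ fun s' => HaltsWithin W q s' T₂ Q) :
    HaltsWithin W (.seq p q) s (T₁ + T₂) Q := by
  obtain ⟨t, s', hexec, ht, t', s'', hexec', ht', hQ⟩ := h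
  exact ⟨_, _, .seq hexec hexec', add_le_add ht ht', hQ⟩

theorem ite {P : Prop} (hb : b.Tests W s P) (hp : P → HaltsWithin W p s T₁ Q)
    (hq : ¬ P → HaltsWithin W q s T₂ Q) :
    HaltsWithin W (.ite b p q) s (b.cost + 1 + max T₁ T₂) Q := by
  by_cases hP : P
  · obtain ⟨t, s', hexec, ht, hQ⟩ := hp hP
    exact ⟨_, _, .ite_true hb.1 (hb.2.eq_zero_iff.not.2 (not_not.2 hP)) hexec,
      Nat.add_le_add_left (ht.trans (le_max_left ..)) _, hQ⟩
  · obtain ⟨t, s', hexec, ht, hQ⟩ := hq hP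
    exact ⟨_, _, .ite_false hb.1 (hb.2.2 hP) hexec,
      Nat.add_le_add_left (ht.trans (le_max_right ..)) _, hQ⟩

theorem loop {B d : ℕ} (J : ℕ → State → Prop) (htest : ∀ d s, J d s → b.Tests W s (d ≠ 0))
    (hbody : ∀ d s, J (d + 1) s → HaltsWithin W p s B (J d)) (hd : J d s) :
    HaltsWithin W (.loop b p) s (d * (b.cost + 1 + B) + (b.cost + 1)) (J 0) := by
  induction d generalizing s with
  | zero =>
    exact ⟨_, s, .loop_false (htest 0 s hd).1 ((htest 0 s hd).2.2 (not_not.2 rfl)), by omega, hd⟩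
  | succ d ih =>
    obtain ⟨t, s', hexec, ht, hd'⟩ := hbody d s hd
    obtain ⟨t', s'', hexec', ht', hJ⟩ := ih hd'
    have htrue := (htest _ s hd).2.eq_zero_iff.not.2 (not_not.2 d.succ_ne_zero)
    exact ⟨_, s'', .loop_true (htest _ s hd).1 htrue hexec hexec', by rw [Nat.succ_mul]; omega, hJ⟩

end HaltsWithin

/-- `for x = 0, …, bound - 1 do body`, where `bound` is evaluated again before every iteration. -/
def Prog.forLoop (x : ℕ) (bound : Expr) (body : Prog) : Prog :=
  .seq (.assign x (.const 0))
    (.loop (.lt (.reg x) bound) (.seq body (.assign x (.add (.reg x) (.const 1)))))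

theorem HaltsWithin.forLoop {W N B x : ℕ} {bound : Expr} {body : Prog} {s : State}
    (I : ℕ → State → Prop) (hW : N + 1 < W) (hx : x ∉ body.writes)
    (hI : ∀ k s v, I k s → I k (s.setReg x v)) (h0 : I 0 s)
    (hbound : ∀ s', s.SameOff (insert x body.writes) s' → bound.Evals W s' N)
    (hbody : ∀ k < N, ∀ s', s.SameOff (insert x body.writes) s' → s'.reg x = k → I k s' →
      HaltsWithin W body s' B (I (k + 1))) :
    HaltsWithin W (.forLoop x bound body) s (N * (B + bound.cost + 7) + bound.cost + 5) (I N) := by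
  let J : ℕ → State → Prop := fun d s' =>
    ∃ k, k + d = N ∧ s'.reg x = k ∧ s.SameOff (insert x body.writes) s' ∧ I k s'
  have hstart : J N (s.setReg x 0) :=
    ⟨0, zero_add N, State.setReg_reg_self .., .setReg (Finset.mem_insert_self ..) _, hI _ _ _ h0⟩
  have htest : ∀ d s', J d s' → (Expr.lt (.reg x) bound).Tests W s' (d ≠ 0) := by
    rintro d s' ⟨k, hk, hxk, hsame, -⟩
    exact (Expr.Tests.lt (by omega) (.reg hxk (by omega)) (hbound s' hsame)).congr (by omega)
  have hiterate : ∀ d s', J (d + 1) s' →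
      HaltsWithin W (.seq body (.assign x (.add (.reg x) (.const 1)))) s' (B + 4) (J d) := by
    rintro d s' ⟨k, hk, hxk, hsame, hIk⟩
    refine .seq ((hbody k (by omega) s' hsame hxk hIk).sameOff.imp ?_)
    rintro s'' ⟨hsame', hIk'⟩
    refine .assign (.add (.reg ((hsame' x hx).trans hxk) (by omega)) (.const (by omega)) (by omega))
      ⟨k + 1, by omega, State.setReg_reg_self .., ?_, hI _ _ _ hIk'⟩
    exact (hsame.trans (hsame'.mono (Finset.subset_insert ..))).trans
      (.setReg (Finset.mem_insert_self ..) _)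
  refine (HaltsWithin.seq (.assign (.const (by omega)) ((HaltsWithin.loop J htest hiterate
    hstart).imp ?_))).of_le (le_of_eq ?_)
  · rintro s' ⟨k, rfl, -, -, hIk⟩
    exact hIk
  · simp only [Expr.cost]
    ring

end RAM

theorem forall_fin_lt_succ_iff {n : ℕ} {P : Fin n → Prop} (k : Fin n) :
    (∀ l : Fin n, (l : ℕ) < k + 1 → P l) ↔ (∀ l : Fin n, (l : ℕ) < k → P l) ∧ P k := by
  simp only [Nat.lt_succ_iff_lt_or_eq, or_imp, forall_and, Fin.val_inj, forall_eq]

namespace Auction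

variable {R : Type*} {n k j : ℕ} {adj : Fin n → R → Prop} {A A' : Auction (Fin n) R}

/-- The situation in the course of round `k + 1`, when the bidders before `j` have had their turn:
a round in which nothing is sold finds all bidders served or somebody priced out. -/
structure InRound [Fintype R] (adj : Fin n → R → Prop) (A : Auction (Fin n) R) (k j : ℕ) :
    Prop where
  isValid : A.IsValid adj
  hasReached : A.HasReached adj k
  progress : A.HasReached adj (k + 1) ∨ ∀ l : Fin n, (l : ℕ) < j → A.Serves l

namespace InRound

variable [Fintype R]

theorem start (hA : A.IsValid adj) (hk : A.HasReached adj k) : A.InRound adj k 0 :=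
  ⟨hA, hk, .inr fun _ hl => absurd hl (Nat.not_lt_zero _)⟩

theorem bid [DecidableEq R] {l : Fin n} (h : A.InRound adj k l) (hbid : A.Bid adj l A') :
    A'.InRound adj k (l + 1) := by
  refine ⟨hbid.isValid h.isValid, hbid.hasReached h.hasReached, ?_⟩
  obtain hk | hserves := h.progress
  · exact .inl (hbid.hasReached hk)
  · obtain ⟨rfl, hl⟩ | hk := hbid.hasReached_succ h.hasReached
    · exact .inr ((forall_fin_lt_succ_iff l).2 ⟨hserves, hl⟩)
    · exact .inl hk

theorem hasReached_succ (h : A.InRound adj k n) : A.HasReached adj (k + 1) :=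
  h.progress.elim id fun hserves => .inr (.inl fun l => hserves l l.isLt)

end InRound

end Auction

/-- The result of a search through the first `k` of `m` offers: no acceptable offer is cheaper
than `p`, and if `p` is below the limit, then `b` is an acceptable offer of price `p`. -/
structure IsBestOffer {m : ℕ} (acceptable : Fin m → Prop) (price : Fin m → ℕ) (limit k b p : ℕ) :
    Prop where
  le_price : ∀ r : Fin m, (r : ℕ) < k → acceptable r → p ≤ price r
  attained : p < limit → ∃ r : Fin m, (r : ℕ) = b ∧ acceptable r ∧ price r = p
  le_limit : p ≤ limit

namespace IsBestOffer

variable {m limit b p : ℕ} {acceptable : Fin m → Prop} {price : Fin m → ℕ} {r : Fin m}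

theorem zero (b : ℕ) : IsBestOffer acceptable price limit 0 b limit :=
  ⟨fun _ h => absurd h (Nat.not_lt_zero _), fun h => absurd h (lt_irrefl _), le_rfl⟩

theorem keep (h : IsBestOffer acceptable price limit r b p)
    (hr : ¬ (acceptable r ∧ price r < p)) :
    IsBestOffer acceptable price limit (r + 1) b p where
  le_price := (forall_fin_lt_succ_iff r).2 ⟨h.le_price, fun ha => not_lt.1 fun hp => hr ⟨ha, hp⟩⟩
  attained := h.attained
  le_limit := h.le_limit

theorem improve (h : IsBestOffer acceptable price limit r b p) (ha : acceptable r)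
    (hp : price r < p) : IsBestOffer acceptable price limit (r + 1) r (price r) where
  le_price := (forall_fin_lt_succ_iff r).2
    ⟨fun r' hr' ha' => hp.le.trans (h.le_price r' hr' ha'), fun _ => le_rfl⟩
  attained _ := ⟨r, rfl, ha, rfl⟩
  le_limit := hp.le.trans h.le_limit

end IsBestOffer

namespace RAM

variable {E : ℕ → ℕ} {n W : ℕ} {i l : Fin n} {r : Fin (n + n)}
  {A : Auction (Fin n) (Fin (n + n))} {s : State}

/-- The bipartite graph of the auction for the deleted vertex `i`. The objects `u < n` and `n + u`
are the vertex `u` as a first vertex and as a vertex in a bi-directed portion, so that row `r` of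
the two stacked adjacency matrices `E` belongs to the object `r`. The vertex `i` itself is paired
off with its own two copies, of which `i < n` is always available to it. -/
def Compatible (E : ℕ → ℕ) (i l : Fin n) (r : Fin (n + n)) : Prop :=
  E (r * n + i) = 0 ∧ (((r : ℕ) = i ∨ (r : ℕ) = n + i) ↔ l = i) ∧
    ((r : ℕ) = l ∨ (r : ℕ) = n + l ∨ E (r * n + l) ≠ 0)

theorem mul_add_lt (r : Fin (n + n)) (l : Fin n) : r * n + l < 2 * (n * n) := by
  have h : ((r : ℕ) + 1) * n ≤ (n + n) * n := Nat.mul_le_mul_right n r.isLt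
  linarith [l.isLt]

/-! ### The program -/

namespace Reg

/-- The number of vertices; in the end, the answer. -/
abbrev size : ℕ := 0

/-- The vertex that is deleted. -/
abbrev vertex : ℕ := 1

/-- The counter for the rounds of the auction. -/
abbrev round : ℕ := 2

/-- The bidder whose turn it is. -/
abbrev bidder : ℕ := 3

/-- The object under consideration; also the counter for clearing the memory. -/
abbrev object : ℕ := 4

/-- The cheapest suitable object found so far. -/
abbrev best : ℕ := 5

/-- The price of the cheapest suitable object, or the number of bidders if there is none. -/
abbrev bestPrice : ℕ := 6

/-- Whether the condition has held for all vertices so far. -/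
abbrev answer : ℕ := 7

end Reg

/-- The place of the auction data in the memory, behind the adjacency matrices: `c = 0` for the
price of the object `v`, `c = 1` for its owner, and `c = 2` for the object that the bidder `v` has
bought. -/
def cellAddr (n v : ℕ) (c : Fin 3) : ℕ := 2 * (n * n) + 3 * v + c

/-- The expression for `cellAddr`. -/
def cell (x : Expr) (c : Fin 3) : Expr :=
  .add (.add (.mul (.const 2) (.mul (.reg Reg.size) (.reg Reg.size))) (.mul (.const 3) x))
    (.const c)

/-- Whether the object is adjacent to the vertex in register `x`. -/
def entry (x : ℕ) : Expr := .load (.add (.mul (.reg Reg.object) (.reg Reg.size)) (.reg x))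

/-- The test for `Compatible`. -/
def compatible : Expr :=
  .and (.not (entry Reg.vertex)) <| .and
    (.iff
      (.or (.eq (.reg Reg.object) (.reg Reg.vertex))
        (.eq (.reg Reg.object) (.add (.reg Reg.size) (.reg Reg.vertex))))
      (.eq (.reg Reg.bidder) (.reg Reg.vertex)))
    (.or (.eq (.reg Reg.object) (.reg Reg.bidder))
      (.or (.eq (.reg Reg.object) (.add (.reg Reg.size) (.reg Reg.bidder))) (entry Reg.bidder)))

/-- The test for `Auction.Serves`. -/
def served : Expr :=
  .eq (.load (cell (.load (cell (.reg Reg.bidder) 2)) 1)) (.add (.reg Reg.bidder) (.const 1))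

/-- Replace the best object by the current one if that is suitable and cheaper. -/
def compareObject : Prog :=
  .ite (.and compatible (.lt (.load (cell (.reg Reg.object) 0)) (.reg Reg.bestPrice)))
    (.seq (.assign Reg.best (.reg Reg.object))
      (.assign Reg.bestPrice (.load (cell (.reg Reg.object) 0))))
    .skip

/-- Find a cheapest suitable object for the bidder. -/
def search : Prog :=
  .seq (.assign Reg.bestPrice (.reg Reg.size))
    (.forLoop Reg.object (.add (.reg Reg.size) (.reg Reg.size)) compareObject)

/-- Sell the best object to the bidder. -/
def sell : Prog :=
  .seq (.store (cell (.reg Reg.best) 0) (.add (.reg Reg.bestPrice) (.const 1))) <|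
    .seq (.store (cell (.reg Reg.best) 1) (.add (.reg Reg.bidder) (.const 1)))
      (.store (cell (.reg Reg.bidder) 2) (.reg Reg.best))

/-- Sell the best object to the bidder if there is one. -/
def buy : Prog := .ite (.lt (.reg Reg.bestPrice) (.reg Reg.size)) sell .skip

/-- The turn of one bidder. -/
def bid : Prog := .ite served .skip (.seq search buy)

/-- The turns of all bidders. -/
def round : Prog := .forLoop Reg.bidder (.reg Reg.size) bid

/-- Enough rounds to reach the end of the auction. -/
def auction : Prog :=
  .forLoop Reg.round
    (.add (.mul (.const 2) (.mul (.reg Reg.size) (.reg Reg.size))) (.const 1)) round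

/-- Clear the memory behind the adjacency matrices. -/
def reset : Prog :=
  .forLoop Reg.object (.mul (.const 6) (.reg Reg.size))
    (.store (.add (.mul (.const 2) (.mul (.reg Reg.size) (.reg Reg.size))) (.reg Reg.object))
      (.const 0))

/-- Set the answer to `0` unless all bidders are served. -/
def checkServed : Prog :=
  .forLoop Reg.bidder (.reg Reg.size) (.assign Reg.answer (.and (.reg Reg.answer) served))

/-- Set the answer to `0` unless the condition holds for the vertex. -/
def checkVertex : Prog := .seq reset (.seq auction checkServed)

/-- The program that decides the graphical condition. -/
def checkCondition : Prog :=
  .seq (.assign Reg.answer (.const 1)) <|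
    .seq (.forLoop Reg.vertex (.reg Reg.size) checkVertex) (.assign Reg.size (.reg Reg.answer))

/-! ### Correctness and running time of the program -/

/-- In the state `s`, the program works on the vertex `i` and has not touched the adjacency
matrices `E`. -/
structure HoldsInput (E : ℕ → ℕ) (i : Fin n) (s : State) : Prop where
  reg_size : s.reg Reg.size = n
  reg_vertex : s.reg Reg.vertex = i
  mem_eq : ∀ a < 2 * (n * n), s.mem a = E a

/-- The owner of an object as a number: `0` for none, `l + 1` for the bidder `l`. -/
def ownerCode (o : Option (Fin n)) : ℕ := o.elim 0 fun l => l + 1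

/-- In addition to the input, the state `s` holds the state `A` of the auction. -/
structure Stores (E : ℕ → ℕ) (i : Fin n) (A : Auction (Fin n) (Fin (n + n))) (s : State) : Prop
    extends HoldsInput E i s where
  price_eq : ∀ r : Fin (n + n), s.mem (cellAddr n r 0) = A.price r
  owner_eq : ∀ r : Fin (n + n), s.mem (cellAddr n r 1) = ownerCode (A.owner r)
  bought_eq : ∀ l : Fin n, s.mem (cellAddr n l 2) = A.bought l

theorem ownerCode_lt (o : Option (Fin n)) : ownerCode o < n + 1 := by
  cases o with
  | none => exact n.succ_pos
  | some l => exact Nat.succ_lt_succ l.isLt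

theorem ownerCode_eq_iff {o : Option (Fin n)} : ownerCode o = l + 1 ↔ o = some l := by
  cases o with
  | none => simp [ownerCode]
  | some l' => simp [ownerCode, Fin.val_inj]

theorem cellAddr_inj {v v' : ℕ} {c c' : Fin 3} :
    cellAddr n v c = cellAddr n v' c' ↔ v = v' ∧ c = c' := by
  rw [cellAddr, cellAddr]
  omega

namespace HoldsInput

theorem setReg (h : HoldsInput E i s) {x : ℕ} (hsize : Reg.size ≠ x) (hvertex : Reg.vertex ≠ x)
    (v : ℕ) : HoldsInput E i (s.setReg x v) where
  reg_size := (State.setReg_reg_of_ne hsize v).trans h.reg_size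
  reg_vertex := (State.setReg_reg_of_ne hvertex v).trans h.reg_vertex
  mem_eq := h.mem_eq

theorem setCell (h : HoldsInput E i s) (v : ℕ) (c : Fin 3) (x : ℕ) :
    HoldsInput E i (s.setMem (cellAddr n v c) x) where
  reg_size := h.reg_size
  reg_vertex := h.reg_vertex
  mem_eq a ha := by
    rw [State.setMem_mem, if_neg (by rw [cellAddr]; omega)]
    exact h.mem_eq a ha

end HoldsInput

namespace Stores

theorem setReg (h : Stores E i A s) {x : ℕ} (hsize : Reg.size ≠ x) (hvertex : Reg.vertex ≠ x)
    (v : ℕ) : Stores E i A (s.setReg x v) where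
  toHoldsInput := h.toHoldsInput.setReg hsize hvertex v
  price_eq := h.price_eq
  owner_eq := h.owner_eq
  bought_eq := h.bought_eq

theorem start (h : HoldsInput E i s) (h0 : ∀ a < 6 * n, s.mem (2 * (n * n) + a) = 0) :
    Stores E i (.start fun _ => ⟨0, Nat.add_pos_left i.pos n⟩) s where
  toHoldsInput := h
  price_eq r := h0 (3 * r) (by omega)
  owner_eq r := h0 (3 * r + 1) (by omega)
  bought_eq l := h0 (3 * l + 2) (by omega)

theorem sell (h : Stores E i A s) (l : Fin n) (r : Fin (n + n)) :
    Stores E i (A.sell l r) (((s.setMem (cellAddr n r 0) (A.price r + 1)).setMem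
      (cellAddr n r 1) (l + 1)).setMem (cellAddr n l 2) r) where
  toHoldsInput := ((h.setCell ..).setCell ..).setCell ..
  price_eq r' := by
    simp only [State.setMem_mem, cellAddr_inj, Fin.val_inj, Fin.reduceEq, and_true, and_false,
      if_false, Auction.sell, Function.update_apply]
    split_ifs
    exacts [rfl, h.price_eq r']
  owner_eq r' := by
    simp only [State.setMem_mem, cellAddr_inj, Fin.val_inj, Fin.reduceEq, and_true, and_false,
      if_false, Auction.sell, Function.update_apply]
    split_ifs
    exacts [rfl, h.owner_eq r']
  bought_eq l' := by
    simp only [State.setMem_mem, cellAddr_inj, Fin.val_inj, Fin.reduceEq, and_true, and_false,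
      if_false, Auction.sell, Function.update_apply]
    split_ifs
    exacts [rfl, h.bought_eq l']

end Stores

theorem HoldsInput.evals_cell (hW : 2 * (n * n) + 6 * n + 4 ≤ W) (h : HoldsInput E i s)
    {x : Expr} {v : ℕ} (hx : x.Evals W s v) (hv : v < n + n) (c : Fin 3) :
    (cell x c).Evals W s (cellAddr n v c) := by
  have hn : (Expr.reg Reg.size).Evals W s n := .reg h.reg_size (by omega)
  have hc := c.isLt
  exact .add (.add (.mul (.const (by omega)) (.mul hn hn (by omega)) (by omega))
    (.mul (.const (by omega)) hx (by omega)) (by omega)) (.const (by omega)) (by omega)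

theorem HoldsInput.tests_entry (hW : 2 * (n * n) + 6 * n + 4 ≤ W) (hE : ∀ a, E a ≤ 1)
    (h : HoldsInput E i s) (hr : s.reg Reg.object = r) {x : ℕ} (hx : s.reg x = l) :
    (entry x).Tests W s (E (r * n + l) ≠ 0) := by
  have haddr := mul_add_lt r l
  have hmem := h.mem_eq _ haddr
  rw [← hmem]
  exact .load (by omega)
    (.add (.mul (.reg hr (by omega)) (.reg h.reg_size (by omega)) (by omega)) (.reg hx (by omega))
      (by omega)) (hmem.trans_le (hE _))

theorem HoldsInput.tests_compatible (hW : 2 * (n * n) + 6 * n + 4 ≤ W) (hE : ∀ a, E a ≤ 1)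
    (h : HoldsInput E i s) (hl : s.reg Reg.bidder = l) (hr : s.reg Reg.object = r) :
    compatible.Tests W s (Compatible E i l r) := by
  have hW₂ : 2 < W := by omega
  have hW₁ : 1 < W := by omega
  have evals_object : (Expr.reg Reg.object).Evals W s r := .reg hr (by omega)
  have evals_size : (Expr.reg Reg.size).Evals W s n := .reg h.reg_size (by omega)
  have evals_vertex : (Expr.reg Reg.vertex).Evals W s i := .reg h.reg_vertex (by omega)
  have evals_bidder : (Expr.reg Reg.bidder).Evals W s l := .reg hl (by omega)
  have tests_vertex := Expr.Tests.or hW₂ (.eq hW₁ evals_object evals_vertex)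
    (.eq hW₁ evals_object (evals_size.add evals_vertex (by omega)))
  have tests_bidder := Expr.Tests.or hW₂ (.eq hW₁ evals_object evals_bidder)
    (.or hW₂ (.eq hW₁ evals_object (evals_size.add evals_bidder (by omega)))
      (h.tests_entry hW hE hr hl))
  refine (Expr.Tests.and hW₁ (.not hW₁ (h.tests_entry hW hE hr h.reg_vertex))
    (.and hW₁ (.iff hW₁ tests_vertex (.eq hW₁ evals_bidder evals_vertex)) tests_bidder)).congr ?_
  simp only [Compatible, not_ne_iff, Fin.val_inj]

theorem Stores.evals_price (hW : 2 * (n * n) + 6 * n + 4 ≤ W) (h : Stores E i A s)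
    (hr : s.reg Reg.object = r) (hprice : A.price r ≤ n) :
    (Expr.load (cell (.reg Reg.object) 0)).Evals W s (A.price r) :=
  .load (h.evals_cell hW (.reg hr (by omega)) r.isLt 0) (h.price_eq r) (by omega)

theorem Stores.tests_served (hW : 2 * (n * n) + 6 * n + 4 ≤ W) (h : Stores E i A s)
    (hl : s.reg Reg.bidder = l) : served.Tests W s (A.Serves l) := by
  have evals_bidder : (Expr.reg Reg.bidder).Evals W s l := .reg hl (by omega)
  have evals_bought := (h.evals_cell hW evals_bidder (by omega) 2).load (h.bought_eq l) (by omega)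
  have hcode := ownerCode_lt (A.owner (A.bought l))
  have evals_owner := (h.evals_cell hW evals_bought (A.bought l).isLt 1).load
    (h.owner_eq (A.bought l)) (by omega)
  exact (Expr.Tests.eq (by omega) evals_owner
    (evals_bidder.add (.const (by omega)) (by omega))).congr ownerCode_eq_iff

/-- The invariant of the search for a cheapest suitable object. -/
structure HasSearched (E : ℕ → ℕ) (i l : Fin n) (A : Auction (Fin n) (Fin (n + n))) (k : ℕ)
    (s : State) : Prop extends Stores E i A s where
  reg_bidder : s.reg Reg.bidder = l
  isBestOffer : IsBestOffer (Compatible E i l) A.price n k (s.reg Reg.best) (s.reg Reg.bestPrice)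

theorem HasSearched.setObject {k : ℕ} (h : HasSearched E i l A k s) (v : ℕ) :
    HasSearched E i l A k (s.setReg Reg.object v) where
  toStores := h.toStores.setReg (by decide) (by decide) v
  reg_bidder := h.reg_bidder
  isBestOffer := h.isBestOffer

theorem HasSearched.setBest (h : HasSearched E i l A r s) (hr : Compatible E i l r)
    (hlt : A.price r < s.reg Reg.bestPrice) :
    HasSearched E i l A (r + 1) ((s.setReg Reg.best r).setReg Reg.bestPrice (A.price r)) where
  toStores := (h.toStores.setReg (by decide) (by decide) _).setReg (by decide) (by decide) _
  reg_bidder := h.reg_bidder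
  isBestOffer := h.isBestOffer.improve hr hlt

theorem haltsWithin_compareObject (hW : 2 * (n * n) + 6 * n + 4 ≤ W) (hE : ∀ a, E a ≤ 1)
    (hA : A.IsValid (Compatible E i)) (h : HasSearched E i l A r s)
    (hr : s.reg Reg.object = r) :
    HaltsWithin W compareObject s 76 (HasSearched E i l A (r + 1)) := by
  have hprice : A.price r ≤ n := (hA.price_le r).trans_eq (Fintype.card_fin n)
  have hbest := h.isBestOffer.le_limit
  have tests := (h.tests_compatible hW hE h.reg_bidder hr).and (by omega)
    (.lt (by omega) (h.evals_price hW hr hprice)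
      (.reg (r := Reg.bestPrice) rfl (hbest.trans_lt (by omega))))
  have hstores := h.toStores.setReg (x := Reg.best) (by decide) (by decide) r
  exact (HaltsWithin.ite tests
    (fun ⟨hcompatible, hlt⟩ => .seq (.assign (.reg hr (by omega))
      (.assign (hstores.evals_price hW hr hprice) (h.setBest hcompatible hlt))))
    fun hnot => .skip { h with isBestOffer := h.isBestOffer.keep hnot }).of_le (by decide)

theorem haltsWithin_search (hW : 2 * (n * n) + 6 * n + 4 ≤ W) (hE : ∀ a, E a ≤ 1)
    (hA : A.IsValid (Compatible E i)) (h : Stores E i A s) (hl : s.reg Reg.bidder = l) :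
    HaltsWithin W search s (172 * n + 10) (HasSearched E i l A (n + n)) := by
  have hstart : HasSearched E i l A 0 (s.setReg Reg.bestPrice n) :=
    ⟨h.setReg (by decide) (by decide) n, hl, .zero _⟩
  refine (HaltsWithin.seq (.assign (.reg h.reg_size (by omega)) (.forLoop (HasSearched E i l A)
    (by omega) (by decide) (fun k s v h => h.setObject v) hstart (fun s' hs' => ?_)
    fun k hk s' _ hk' h' => haltsWithin_compareObject (r := ⟨k, hk⟩) hW hE hA h' hk'))).of_le ?_
  · have hn := (hs' Reg.size (by decide)).trans h.reg_size
    exact .add (.reg hn (by omega)) (.reg hn (by omega)) (by omega)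
  · simp only [Expr.cost]
    linarith

theorem haltsWithin_sell (hW : 2 * (n * n) + 6 * n + 4 ≤ W) (h : Stores E i A s)
    (hl : s.reg Reg.bidder = l) (hr : s.reg Reg.best = r)
    (hprice : s.reg Reg.bestPrice = A.price r) (hle : A.price r ≤ n) :
    HaltsWithin W sell s 43 (Stores E i (A.sell l r)) := by
  have evals_best {s' : State} (hs' : s'.reg = s.reg) : (Expr.reg Reg.best).Evals W s' r :=
    .reg (hs' ▸ hr) (by omega)
  have evals_bidder {s' : State} (hs' : s'.reg = s.reg) : (Expr.reg Reg.bidder).Evals W s' l :=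
    .reg (hs' ▸ hl) (by omega)
  have h₁ := h.setCell r 0 (A.price r + 1)
  have h₂ := h₁.setCell r 1 (l + 1)
  refine (HaltsWithin.seq (.store (h.evals_cell hW (evals_best rfl) r.isLt 0)
    (.add (.reg hprice (by omega)) (.const (by omega)) (by omega))
    (.seq (.store (h₁.evals_cell hW (evals_best rfl) r.isLt 1)
      (.add (evals_bidder rfl) (.const (by omega)) (by omega))
      (.store (h₂.evals_cell hW (evals_bidder rfl) (by omega) 2) (evals_best rfl)
        (h.sell l r)))))).of_le (by decide)

theorem haltsWithin_buy (hW : 2 * (n * n) + 6 * n + 4 ≤ W) (hl : ¬ A.Serves l)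
    (h : HasSearched E i l A (n + n) s) :
    HaltsWithin W buy s 47 fun s' => ∃ A', A.Bid (Compatible E i) l A' ∧ Stores E i A' s' := by
  have hbest := h.isBestOffer
  have hle := hbest.le_limit
  have tests : (Expr.lt (.reg Reg.bestPrice) (.reg Reg.size)).Tests W s
      (s.reg Reg.bestPrice < n) := .lt (by omega) (.reg rfl (by omega)) (.reg h.reg_size (by omega))
  have hsell (hlt : s.reg Reg.bestPrice < n) : HaltsWithin W sell s 43
      fun s' => ∃ A', A.Bid (Compatible E i) l A' ∧ Stores E i A' s' := by
    obtain ⟨r, hr, hcompatible, hprice⟩ := hbest.attained hlt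
    exact (haltsWithin_sell hW h.toStores h.reg_bidder hr.symm hprice.symm
      (hprice.trans_le hle)).imp fun s' h' => ⟨_, .buy hl hcompatible
        (by rwa [hprice, Fintype.card_fin])
        fun r' hr' => hprice.trans_le (hbest.le_price r' r'.isLt hr'), h'⟩
  have hpriced_out (hge : ¬ s.reg Reg.bestPrice < n) : A.PricedOut (Compatible E i) l :=
    ⟨hl, fun r hr => (Fintype.card_fin n).trans_le
      ((not_lt.1 hge).trans (hbest.le_price r r.isLt hr))⟩
  exact (HaltsWithin.ite tests hsell
    fun hge => .skip ⟨A, .pricedOut (hpriced_out hge), h.toStores⟩).of_le (by decide)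

theorem haltsWithin_bid (hW : 2 * (n * n) + 6 * n + 4 ≤ W) (hE : ∀ a, E a ≤ 1)
    (hA : A.IsValid (Compatible E i)) (h : Stores E i A s) (hl : s.reg Reg.bidder = l) :
    HaltsWithin W bid s (172 * n + 85)
      fun s' => ∃ A', A.Bid (Compatible E i) l A' ∧ Stores E i A' s' := by
  refine (HaltsWithin.ite (h.tests_served hW hl) (fun hserves => .skip ⟨A, .served hserves, h⟩)
    fun hserves => .seq ((haltsWithin_search hW hE hA h hl).imp
      fun s' => haltsWithin_buy hW hserves)).of_le ?_
  rw [max_eq_right (by omega)]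
  exact le_of_eq (by simp only [served, cell, Expr.cost]; ring)

theorem haltsWithin_round {k : ℕ} (hW : 2 * (n * n) + 6 * n + 4 ≤ W) (hE : ∀ a, E a ≤ 1)
    (hA : A.IsValid (Compatible E i)) (hk : A.HasReached (Compatible E i) k)
    (h : Stores E i A s) :
    HaltsWithin W round s (n * (172 * n + 93) + 6) fun s' =>
      ∃ A', A'.IsValid (Compatible E i) ∧ A'.HasReached (Compatible E i) (k + 1) ∧
        Stores E i A' s' := by
  let I (j : ℕ) (s' : State) : Prop :=
    ∃ A' : Auction (Fin n) (Fin (n + n)), A'.InRound (Compatible E i) k j ∧ Stores E i A' s'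
  have hI (j : ℕ) (s' : State) (v : ℕ) : I j s' → I j (s'.setReg Reg.bidder v) :=
    fun ⟨A', hA', h'⟩ => ⟨A', hA', h'.setReg (by decide) (by decide) v⟩
  refine ((HaltsWithin.forLoop I (N := n) (B := 172 * n + 85) (by omega) (by decide) hI
    ⟨A, .start hA hk, h⟩ (fun s' hs' => ?_) ?_).imp ?_).of_le le_rfl
  · exact .reg ((hs' Reg.size (by decide)).trans h.reg_size) (by omega)
  · rintro j hj s' - hjs' ⟨A', hA', h'⟩
    exact (haltsWithin_bid (l := ⟨j, hj⟩) hW hE hA'.isValid h' hjs').imp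
      fun s'' ⟨A'', hbid, h''⟩ => ⟨A'', hA'.bid hbid, h''⟩
  · rintro s' ⟨A', hA', h'⟩
    exact ⟨A', hA'.isValid, hA'.hasReached_succ, h'⟩

theorem haltsWithin_auction (hW : 2 * (n * n) + 6 * n + 4 ≤ W) (hE : ∀ a, E a ≤ 1)
    (hA : A.IsValid (Compatible E i)) (h : Stores E i A s) :
    HaltsWithin W auction s ((2 * (n * n) + 1) * (n * (172 * n + 93) + 20) + 12) fun s' =>
      ∃ A', A'.IsValid (Compatible E i) ∧ A'.IsFinal (Compatible E i) ∧ Stores E i A' s' := by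
  let I (k : ℕ) (s' : State) : Prop := ∃ A' : Auction (Fin n) (Fin (n + n)),
    A'.IsValid (Compatible E i) ∧ A'.HasReached (Compatible E i) k ∧ Stores E i A' s'
  have hI (k : ℕ) (s' : State) (v : ℕ) : I k s' → I k (s'.setReg Reg.round v) :=
    fun ⟨A', hA', hk, h'⟩ => ⟨A', hA', hk, h'.setReg (by decide) (by decide) v⟩
  have hn := i.pos
  refine ((HaltsWithin.forLoop I (N := 2 * (n * n) + 1) (B := n * (172 * n + 93) + 6) (by omega)
    (by decide) hI ⟨A, hA, .inl (Nat.zero_le _), h⟩ (fun s' hs' => ?_) ?_).imp ?_).of_le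
      (le_of_eq (by simp only [Expr.cost]))
  · have evals_size : (Expr.reg Reg.size).Evals W s' n :=
      .reg ((hs' Reg.size (by decide)).trans h.reg_size) (by omega)
    exact .add (.mul (.const (by omega)) (.mul evals_size evals_size (by omega)) (by omega))
      (.const (by omega)) (by omega)
  · rintro k - s' - - ⟨A', hA', hk, h'⟩
    exact haltsWithin_round hW hE hA' hk h'
  · rintro s' ⟨A', hA', hk, h'⟩
    refine ⟨A', hA', hk.resolve_left fun hk => ?_, h'⟩
    have hle := hA'.revenue_le
    rw [Fintype.card_fin, Fintype.card_fin, add_mul] at hle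
    omega

theorem haltsWithin_reset (hW : 2 * (n * n) + 6 * n + 4 ≤ W) (h : HoldsInput E i s) :
    HaltsWithin W reset s (114 * n + 8)
      (Stores E i (.start fun _ => ⟨0, Nat.add_pos_left i.pos n⟩)) := by
  have hn := i.pos
  let I (k : ℕ) (s' : State) : Prop :=
    HoldsInput E i s' ∧ ∀ a < k, s'.mem (2 * (n * n) + a) = 0
  have hI (k : ℕ) (s' : State) (v : ℕ) (h' : I k s') : I k (s'.setReg Reg.object v) :=
    ⟨h'.1.setReg (by decide) (by decide) v, h'.2⟩
  refine ((HaltsWithin.forLoop I (N := 6 * n) (B := 9) (by omega) (by decide) hI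
    ⟨h, fun a ha => absurd ha (Nat.not_lt_zero a)⟩ (fun s' hs' => ?_) ?_).imp
      fun s' h' => .start h'.1 h'.2).of_le (by simp only [Expr.cost]; linarith)
  · exact .mul (.const (by omega)) (.reg ((hs' Reg.size (by decide)).trans h.reg_size) (by omega))
      (by omega)
  · rintro k hk s' - hks' ⟨h', h0⟩
    have evals_size : (Expr.reg Reg.size).Evals W s' n := .reg h'.reg_size (by omega)
    refine .store (.add (.mul (.const (by omega)) (.mul evals_size evals_size (by omega))
      (by omega)) (.reg hks' (by omega)) (by omega)) (.const (by omega))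
        ⟨⟨h'.reg_size, h'.reg_vertex, fun a ha => ?_⟩, fun a ha => ?_⟩ <;> rw [State.setMem_mem]
    · rw [if_neg (by omega)]
      exact h'.mem_eq a ha
    · split_ifs with hak
      · rfl
      · exact h0 a (by omega)

theorem haltsWithin_checkServed {p : Prop} (hW : 2 * (n * n) + 6 * n + 4 ≤ W)
    (h : Stores E i A s) (hp : IsTruthValue (s.reg Reg.answer) p) :
    HaltsWithin W checkServed s (38 * n + 6) fun s' =>
      HoldsInput E i s' ∧ IsTruthValue (s'.reg Reg.answer) (p ∧ ∀ l, A.Serves l) := by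
  let I (k : ℕ) (s' : State) : Prop := Stores E i A s' ∧
    IsTruthValue (s'.reg Reg.answer) (p ∧ ∀ l : Fin n, (l : ℕ) < k → A.Serves l)
  have hI (k : ℕ) (s' : State) (v : ℕ) (h' : I k s') : I k (s'.setReg Reg.bidder v) :=
    ⟨h'.1.setReg (by decide) (by decide) v, h'.2⟩
  refine ((HaltsWithin.forLoop I (N := n) (B := 30) (by omega) (by decide) hI
    ⟨h, hp.congr (by simp)⟩ (fun s' hs' => ?_) ?_).imp ?_).of_le
      (by simp only [Expr.cost]; linarith)
  · exact .reg ((hs' Reg.size (by decide)).trans h.reg_size) (by omega)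
  · rintro k hk s' - hks' ⟨h', hp'⟩
    have tests := (Expr.Tests.reg (by omega) hp').and (by omega)
      (h'.tests_served (l := ⟨k, hk⟩) hW hks')
    exact .assign tests.evals ⟨h'.setReg (by decide) (by decide) _, tests.2.congr
      (by rw [and_assoc, ← forall_fin_lt_succ_iff ⟨k, hk⟩])⟩
  · rintro s' ⟨h', hp'⟩
    exact ⟨h'.toHoldsInput, hp'.congr (by simp)⟩

theorem haltsWithin_checkVertex {p : Prop} (hW : 2 * (n * n) + 6 * n + 4 ≤ W)
    (hE : ∀ a, E a ≤ 1) (h : HoldsInput E i s) (hp : IsTruthValue (s.reg Reg.answer) p) :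
    HaltsWithin W checkVertex s (800 * (n + 1) ^ 4) fun s' =>
      HoldsInput E i s' ∧ IsTruthValue (s'.reg Reg.answer) (p ∧ HasMatching (Compatible E i)) := by
  refine (HaltsWithin.seq ((haltsWithin_reset hW h).sameOff.imp fun s₁ ⟨hs₁, h₁⟩ =>
    .seq (T₂ := 38 * n + 6)
      ((haltsWithin_auction hW hE (Auction.isValid_start _ _) h₁).sameOff.imp ?_))).of_le ?_
  · rintro s₂ ⟨hs₂, A, hA, hfinal, h₂⟩
    rw [hA.hasMatching_iff hfinal]
    refine haltsWithin_checkServed hW h₂ ?_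
    rwa [hs₂ Reg.answer (by decide), hs₁ Reg.answer (by decide)]
  · ring_nf
    omega

theorem haltsWithin_checkVertices (hW : 2 * (n * n) + 6 * n + 4 ≤ W) (hE : ∀ a, E a ≤ 1)
    (hn : s.reg Reg.size = n) (hmem : ∀ a < 2 * (n * n), s.mem a = E a)
    (hanswer : s.reg Reg.answer = 1) :
    HaltsWithin W (.forLoop Reg.vertex (.reg Reg.size) checkVertex) s
      (n * (800 * (n + 1) ^ 4 + 8) + 6) fun s' =>
        IsTruthValue (s'.reg Reg.answer) (∀ i : Fin n, HasMatching (Compatible E i)) := by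
  let I (k : ℕ) (s' : State) : Prop := (∀ a < 2 * (n * n), s'.mem a = E a) ∧
    IsTruthValue (s'.reg Reg.answer) (∀ i : Fin n, (i : ℕ) < k → HasMatching (Compatible E i))
  have hI (k : ℕ) (s' : State) (v : ℕ) : I k s' → I k (s'.setReg Reg.vertex v) := id
  have h0 : I 0 s :=
    ⟨hmem, fun _ => hanswer, fun h => absurd (fun _ hi => absurd hi (Nat.not_lt_zero _)) h⟩
  have reg_size {s' : State} (hs' : s.SameOff (insert Reg.vertex checkVertex.writes) s') :
      s'.reg Reg.size = n := (hs' Reg.size (by decide)).trans hn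
  refine (HaltsWithin.forLoop I (N := n) (B := 800 * (n + 1) ^ 4) (by omega) (by decide) hI h0
    (fun s' hs' => .reg (reg_size hs') (by omega)) ?_).imp ?_
  · rintro k hk s' hs' hks' ⟨hmem', hp⟩
    refine (haltsWithin_checkVertex (i := ⟨k, hk⟩) hW hE ⟨reg_size hs', hks', hmem'⟩ hp).imp ?_
    rintro s'' ⟨h, hp'⟩
    exact ⟨h.mem_eq, hp'.congr (forall_fin_lt_succ_iff ⟨k, hk⟩).symm⟩
  · rintro s' ⟨-, hp⟩
    exact hp.congr (by simp)

theorem haltsWithin_checkCondition (hW : 2 * (n * n) + 6 * n + 4 ≤ W) (hE : ∀ a, E a ≤ 1)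
    (hn : s.reg Reg.size = n) (hmem : ∀ a < 2 * (n * n), s.mem a = E a) :
    HaltsWithin W checkCondition s (1000 * (n + 1) ^ 5) fun s' =>
      IsTruthValue (s'.reg 0) (∀ i : Fin n, HasMatching (Compatible E i)) := by
  have hcheck := haltsWithin_checkVertices (s := s.setReg Reg.answer 1) hW hE hn hmem rfl
  have hoverwrite (s' : State) (hp : IsTruthValue (s'.reg Reg.answer)
      (∀ i : Fin n, HasMatching (Compatible E i))) :
      HaltsWithin W (.assign Reg.size (.reg Reg.answer)) s' 2 fun s' =>
        IsTruthValue (s'.reg 0) (∀ i : Fin n, HasMatching (Compatible E i)) :=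
    .assign (.reg rfl (hp.le_one.trans_lt (by omega))) hp
  refine (HaltsWithin.seq (.assign (.const (by omega)) (.seq (hcheck.imp hoverwrite)))).of_le ?_
  simp only [Expr.cost]
  ring_nf
  omega

end RAM

/-! ### Correctness of the encoding -/

theorem mul_add_inj {n a a' : ℕ} {l l' : Fin n} : a * n + l = a' * n + l' ↔ a = a' ∧ l = l' := by
  refine ⟨fun h => ?_, by rintro ⟨rfl, rfl⟩; rfl⟩
  have hmod := congrArg (· % n) h
  simp only [Nat.mul_add_mod', Nat.mod_eq_of_lt l.isLt, Nat.mod_eq_of_lt l'.isLt] at hmod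
  rw [hmod, Nat.add_right_cancel_iff] at h
  exact ⟨Nat.eq_of_mul_eq_mul_right l.pos h, Fin.ext hmod⟩

namespace MixedGraph

variable {V : Type*} {n : ℕ}

theorem input_mem_le_one (G : MixedGraph V) (e : V ≃ Fin n) (a : ℕ) : (G.input e).mem a ≤ 1 := by
  simp only [input]
  split_ifs <;> simp

theorem input_mem_ne_zero_iff (G : MixedGraph V) (e : V ≃ Fin n) (a : ℕ) (v : V) :
    (G.input e).mem (a * n + e v) ≠ 0 ↔
      (∃ u, G.Dir u v ∧ a = e u) ∨ ∃ u, G.Bi.Adj u v ∧ a = n + e u := by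
  simp only [input, ne_eq, ite_eq_right_iff, one_ne_zero, imp_false, not_not, ← add_assoc,
    ← add_mul, mul_add_inj, e.apply_eq_iff_eq]
  grind

theorem input_mem_dir (G : MixedGraph V) (e : V ≃ Fin n) (u v : V) :
    (G.input e).mem (e u * n + e v) ≠ 0 ↔ G.Dir u v := by
  have hne (w : V) : (e u : ℕ) ≠ n + e w := by omega
  simp [input_mem_ne_zero_iff, hne, Fin.val_inj]

theorem input_mem_bi (G : MixedGraph V) (e : V ≃ Fin n) (u v : V) :
    (G.input e).mem ((n + e u) * n + e v) ≠ 0 ↔ G.Bi.Adj u v := by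
  have hne (w : V) : n + (e u : ℕ) ≠ e w := by omega
  simp [input_mem_ne_zero_iff, hne, Fin.val_inj]

theorem compatible_castAdd_iff (G : MixedGraph V) (e : V ≃ Fin n) (i v u : V) :
    RAM.Compatible (G.input e).mem (e i) (e v) (Fin.castAdd n (e u)) ↔
      ¬ G.Dir u i ∧ (u = i ↔ v = i) ∧ (u = v ∨ G.Dir u v) := by
  have hne (w : V) : (e u : ℕ) ≠ n + e w := by omega
  simp only [RAM.Compatible, Fin.val_castAdd, ← G.input_mem_dir e, not_not, Fin.val_inj,
    e.apply_eq_iff_eq, hne, or_false, false_or]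

theorem compatible_natAdd_iff (G : MixedGraph V) (e : V ≃ Fin n) (i v u : V) :
    RAM.Compatible (G.input e).mem (e i) (e v) (Fin.natAdd n (e u)) ↔
      ¬ G.Bi.Adj u i ∧ (u = i ↔ v = i) ∧ (u = v ∨ G.Bi.Adj u v) := by
  have hne (w : V) : n + (e u : ℕ) ≠ e w := by omega
  simp only [RAM.Compatible, Fin.val_natAdd, ← G.input_mem_bi e, not_not, Fin.val_inj,
    Nat.add_left_cancel_iff, e.apply_eq_iff_eq, hne, false_or]

theorem hasMatching_compatible_iff (G : MixedGraph V) (e : V ≃ Fin n) (i : V) :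
    HasMatching (RAM.Compatible (G.input e).mem (e i)) ↔
      HasMatching ((G.induce {i}ᶜ).IsPredecessor (Subtype.val ⁻¹' (G.pa i ∪ {i})ᶜ)
        (Subtype.val ⁻¹' G.sib i)) := by
  let ι (v : ({i}ᶜ : Set V)) : Fin n := e v
  have hι : ι.Injective := e.injective.comp Subtype.val_injective
  refine hasMatching_iff_of_injective hι
    (κ := finSumFinEquiv ∘ Sum.map ι ι) (finSumFinEquiv.injective.comp (hι.sumMap hι))
    (l₀ := e i) (r₀ := Fin.castAdd n (e i)) ?_ ?_ ?_ ?_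
  · refine e.forall_congr_right.1 fun v => ?_
    obtain rfl | hv := eq_or_ne v i
    exacts [.inl rfl, .inr ⟨⟨v, hv⟩, rfl⟩]
  · rw [← finSumFinEquiv_apply_left, Set.range_comp, finSumFinEquiv.injective.mem_set_image]
    simp [ι]
  · exact (G.compatible_castAdd_iff e i i i).2 ⟨G.dir_irrefl i, Iff.rfl, .inl rfl⟩
  · intro v r
    obtain ⟨u, rfl⟩ := finSumFinEquiv.surjective r
    have hv : (v : V) ≠ i := v.2
    obtain u | u := u <;> obtain ⟨u, rfl⟩ := e.surjective u
    · rw [finSumFinEquiv_apply_left, compatible_castAdd_iff, ← finSumFinEquiv_apply_left]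
      simp only [Function.comp_apply, finSumFinEquiv.apply_eq_iff_eq]
      simp [ι, IsPredecessor, induce, pa, hv, Subtype.ext_iff, and_assoc, and_left_comm]
    · rw [finSumFinEquiv_apply_right, compatible_natAdd_iff, ← finSumFinEquiv_apply_right]
      simp only [Function.comp_apply, finSumFinEquiv.apply_eq_iff_eq]
      simp [ι, IsPredecessor, induce, sib, hv, Subtype.ext_iff]

theorem graphicalCondition_iff (G : MixedGraph V) (e : V ≃ Fin n) :
    G.GraphicalCondition ↔ ∀ i : Fin n, HasMatching (RAM.Compatible (G.input e).mem i) := by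
  have : Finite V := .of_equiv _ e.symm
  rw [← e.forall_congr_right]
  exact forall_congr' fun i =>
    exists_halfColliderSystem_iff.trans (G.hasMatching_compatible_iff e i).symm

end MixedGraph

theorem isBigO_mul_succ_pow (C k : ℕ) :
    Asymptotics.IsBigO Filter.atTop (fun n : ℕ => ((C * (n + 1) ^ k : ℕ) : ℝ))
      fun n : ℕ => (n : ℝ) ^ k := by
  refine .of_bound (C * 2 ^ k) (Filter.eventually_atTop.2 ⟨1, fun n hn => ?_⟩)
  rw [Real.norm_natCast, norm_pow, Real.norm_natCast, mul_assoc, ← mul_pow]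
  norm_cast
  gcongr
  omega

/-- One RAM program with words of `O(log |V|)` bits checks the graphical condition for all finite
mixed graphs in `O(|V|⁵)` operations; register `0` holds the answer (`1` for yes, `0` for no). -/
theorem mainTheorem6 :
    ∃ (P : RAM.Prog) (c : ℕ) (T : ℕ → ℕ),
      Asymptotics.IsBigO Filter.atTop (fun n : ℕ => (T n : ℝ)) (fun n : ℕ => (n : ℝ) ^ 5) ∧
      ∀ (V : Type*) [Fintype V] (G : MixedGraph V) (e : V ≃ Fin (Fintype.card V)),
        ∃ (t : ℕ) (s : RAM.State),
          RAM.Exec ((Fintype.card V + 2) ^ c) P (G.input e) t s ∧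
          t ≤ T (Fintype.card V) ∧
          (G.GraphicalCondition → s.reg 0 = 1) ∧
          (¬ G.GraphicalCondition → s.reg 0 = 0) := by
  refine ⟨RAM.checkCondition, 3, fun n => 1000 * (n + 1) ^ 5, isBigO_mul_succ_pow 1000 5,
    fun V _ G e => ?_⟩
  have hW : 2 * (Fintype.card V * Fintype.card V) + 6 * Fintype.card V + 4 ≤
      (Fintype.card V + 2) ^ 3 := by
    ring_nf
    omega
  obtain ⟨t, s, hexec, ht, hs⟩ := RAM.haltsWithin_checkCondition (n := Fintype.card V) hW
    (G.input_mem_le_one e) rfl fun _ _ => rfl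
  exact ⟨t, s, hexec, ht, hs.congr (G.graphicalCondition_iff e).symm⟩
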